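/- Let $Z_+\in\mathbb R$ and $\mu\in\mathbb C$, and put $q(\tau)=\frac{\mu}{1+\tau^2}-\frac{Z_+}{\sqrt{1+\tau^2}}$ for $\tau>0$. For an integer $j\ge 1$ let $\Omega_j=\{k\in\mathbb C: |k|^2>1/j\}$, and call a real function $l\in C^2((0,\infty))$ an admissible long range part of level $j$ if $|l|\le 1/j$ on $(0,\infty)$, $l(\tau)=-Z_+/\sqrt{1+\tau^2}$ for all large $\tau$, and $q-l\in L^1((0,\infty))$. A global phase function is a function $\phi(\xi,k)$ such that for every $j\ge1$ there are an admissible long range part $l_j$ of level $j$, an analytic function $g_j$ on $\Omega_j$ and a number $\widetilde R_j$ with $$\phi(\xi,k)=\int_0^{\sinh\xi}\sqrt{k^2-l_j(\tau)}\,d\tau+g_j(k)\qquad\text{for }\xi>\widetilde R_j,\ k\in\Omega_j,$$ where $\sqrt{k^2-l}:=k\sqrt{1-l/k^2}$ with the principal square root on the right, and such that for every $k\ne0$ one has $\phi(\xi,-k)=-\phi(\xi,k)$ for all large $\xi$. Let $\phi$ be a global phase function, let $\mathbb C_{+}$ and $\mathbb C_-$ be the open upper and lower half-planes, and consider, for $\xi>0$,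 the radial equation $$v''(\xi)+\bigl(k^2\cosh^2\xi+Z_+\cosh\xi-\mu\bigr)v(\xi)=0.\tag{1}$$ For each choice of the sign $\pm$ there is a family $v_\pm(\xi,k)$, $\xi>0$, $k\in\mathbb C\setminus\{0\}$, with the following properties. 1. For every $k\in\mathbb C\setminus\{0\}$ the function $v_\pm(\cdot,k)$ solves (1) and $$v_\pm(\xi,k)=\sqrt2\,e^{-\xi/2}\exp\bigl(\pm i\phi(\xi,k)\bigr)\,(1+o(1))\qquad\text{as }\xi\to\infty.\tag{2}$$ 2. For every $k\in\overline{\mathbb C}_\pm\setminus\{0\}$ it is the only solution of (1) on $(0,\infty)$ satisfying (2). 3. For all $\eta\ge0$ and $\delta>0$, (2) holds uniformly for $k$ in the truncated cone $\Lambda_\pm(\eta,\delta)=\{k\in\mathbb C\setminus\{0\}:\eta\le\arg(\pm k)\le\pi-\eta,\ |k|\ge\delta\}$, where $\arg$ takes values in $(-\pi,\pi]$. 4. For every $\xi>0$ the function $k\mapsto v_\pm(\xi,k)$ is analytic in $\mathbb C_\pm$ and continuous on $\overline{\mathbb C}_\pm\setminus\{0\}$. -/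

import Mathlib

open Filter Topology Set MeasureTheory

noncomputable section

namespace TwoCentre

/-- `v` is a solution on `ξ > 0` of the radial equation
`v'' + (k² cosh² ξ + Z cosh ξ - μ) v = 0`; the witness `v'` is its first derivative. -/
def IsRadialSolution (Z : ℝ) (μ k : ℂ) (v : ℝ → ℂ) : Prop :=
  ∃ v' : ℝ → ℂ, ∀ ξ : ℝ, 0 < ξ →
    HasDerivAt v (v' ξ) ξ ∧
    HasDerivAt v' (-((k ^ 2 * (Real.cosh ξ : ℂ) ^ 2 + (Z : ℂ) * (Real.cosh ξ : ℂ) - μ) * v ξ)) ξ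

/-- The potential `q(τ) = μ / (1 + τ²) - Z / √(1 + τ²)` in the variable `τ = sinh ξ`. -/
def potential (Z : ℝ) (μ : ℂ) (τ : ℝ) : ℂ :=
  μ / (1 + (τ : ℂ) ^ 2) - ((Z / Real.sqrt (1 + τ ^ 2) : ℝ) : ℂ)

/-- `l` is an admissible long range part of level `j`: `q = s + l` on `(0, ∞)` with `s` in `L¹`,
`l` real and of class `C²`, `|l| ≤ 1 / j`, and `l(τ) = -Z / √(1 + τ²)` for large `τ`. -/
structure IsLongRangePart (Z : ℝ) (μ : ℂ) (j : ℕ) (l : ℝ → ℝ) : Prop where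
  contDiffOn : ContDiffOn ℝ 2 l (Ioi 0)
  abs_le : ∀ τ : ℝ, 0 < τ → |l τ| ≤ 1 / (j : ℝ)
  eq_of_large : ∃ R : ℝ, ∀ τ : ℝ, R < τ → l τ = -(Z / Real.sqrt (1 + τ ^ 2))
  shortRange_integrable : IntegrableOn (fun τ : ℝ => potential Z μ τ - (l τ : ℂ)) (Ioi 0)

/-- `Ω_j = {k : |k|² > 1 / j}`. -/
def Omega (j : ℕ) : Set ℂ := {k : ℂ | 1 / (j : ℝ) < ‖k‖ ^ 2}

/-- The phase `∫₀^{sinh ξ} √(k² - l(τ)) dτ`. The square root is the branch that is analytic in `k`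
on `|k|² > sup |l|` and positive for large positive `k`, that is `k √(1 - l / k²)` with the
principal root. -/
def localPhase (l : ℝ → ℝ) (ξ : ℝ) (k : ℂ) : ℂ :=
  ∫ τ in (0 : ℝ)..Real.sinh ξ, k * (1 - (l τ : ℂ) / k ^ 2) ^ (1 / 2 : ℂ)

/-- `φ(ξ, k)` is a global phase function: for every `j ≥ 1` it agrees, for large `ξ` and all
`k ∈ Ω_j`, with the phase of an admissible long range part of level `j` up to a function analytic in
`Ω_j`, and it is odd in `k`. For each `k` only the germ of `φ(·, k)` at infinity matters. -/
structure IsGlobalPhase (Z : ℝ) (μ : ℂ) (φ : ℝ → ℂ → ℂ) : Prop where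
  patch : ∀ j : ℕ, 1 ≤ j → ∃ l : ℝ → ℝ, IsLongRangePart Z μ j l ∧
    ∃ g : ℂ → ℂ, AnalyticOnNhd ℂ g (Omega j) ∧
      ∃ R : ℝ, ∀ ξ : ℝ, R < ξ → ∀ k ∈ Omega j, φ ξ k = localPhase l ξ k + g k
  odd : ∀ k : ℂ, k ≠ 0 → ∀ᶠ ξ : ℝ in atTop, φ ξ (-k) = -φ ξ k

/-- The leading term `√2 e^{-ξ/2} exp(σ i φ(ξ, k))`, for a sign `σ = ±1`. -/
def leadingTerm (σ : ℝ) (φ : ℝ → ℂ → ℂ) (ξ : ℝ) (k : ℂ) : ℂ :=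
  ((Real.sqrt 2 * Real.exp (-ξ / 2) : ℝ) : ℂ) * Complex.exp ((σ : ℂ) * Complex.I * φ ξ k)

/-- `v(ξ) = √2 e^{-ξ/2} exp(σ i φ(ξ, k)) (1 + o(1))` as `ξ → ∞`. -/
def HasAsymptotics (σ : ℝ) (φ : ℝ → ℂ → ℂ) (k : ℂ) (v : ℝ → ℂ) : Prop :=
  Tendsto (fun ξ : ℝ => v ξ / leadingTerm σ φ ξ k) atTop (𝓝 1)

/-- The truncated cone `Λ_σ(η, δ)`. -/
def truncatedCone (σ η δ : ℝ) : Set ℂ :=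
  {k : ℂ | k ≠ 0 ∧ η ≤ Complex.arg ((σ : ℂ) * k) ∧ Complex.arg ((σ : ℂ) * k) ≤ Real.pi - η ∧
    δ ≤ ‖k‖}

/-- The open upper (`σ = 1`) or lower (`σ = -1`) half-plane. -/
def halfPlane (σ : ℝ) : Set ℂ := {k : ℂ | 0 < σ * k.im}

end TwoCentre

end

/-!
The Liouville–Green method compares (1) with `y = (cosh ξ)^{-1/2} e^{iψ}`, where
`ψ = k sinh ξ + Z ξ / (2k)`. Write a solution as `y m` with `m' = b cosh ξ`. The pair
`(m + b / (2ik), e^{ξ/2} b)` solves a Volterra equation on `(ξ, ∞)` whose kernel is `O(e^{-t/2})`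
uniformly for `Im k ≥ 0`, `|k| ≥ δ`, because `Im (ψ(t) - ψ(ξ))` is bounded below for `ξ ≤ t`. Its
Picard series yields a solution asymptotic to `y`, together with uniformity in `k` and analyticity.
The equation depends on `k²` only, so for `Im k < 0` the solution at `-k` decays, and reduction of
order completes it by a growing one. Two solutions with the same asymptotics differ by a combination
`α y (1 + o(1)) + β y e^{-2iψ} (1 + o(1))` that is `o(y)`; as `e^{-2iψ}` has no limit for
`Im k ≥ 0`, `α = β = 0`. Finally `φ - ψ` converges as `ξ → ∞`, locally uniformly in `k ≠ 0`, to an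
analytic function of `k`, which turns asymptotics in terms of `ψ` into asymptotics in terms of `φ`.
-/

noncomputable section

namespace TwoCentre

section HolomorphicIntegral

variable {E : Type*} [NormedAddCommGroup E] [NormedSpace ℂ E] {α : Type*} [MeasurableSpace α]
  {ν : Measure α} {U : Set ℂ} {f : ℂ → α → E}

theorem aestronglyMeasurable_deriv_param (hU : IsOpen U)
    (hmeas : ∀ k ∈ U, AEStronglyMeasurable (f k) ν)
    (hdiff : ∀ᵐ x ∂ν, DifferentiableOn ℂ (fun k => f k x) U) {k : ℂ} (hk : k ∈ U) :
    AEStronglyMeasurable (fun x => deriv (fun k => f k x) k) ν := by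
  obtain ⟨z, hz⟩ := exists_seq_tendsto (𝓝[≠] (0 : ℂ))
  have hzU : ∀ᶠ n in atTop, k + z n ∈ U := by
    have hadd : Tendsto (fun n => k + z n) atTop (𝓝 k) := by
      simpa using (hz.mono_right nhdsWithin_le_nhds).const_add k
    exact hadd.eventually (hU.mem_nhds hk)
  obtain ⟨N, hN⟩ := eventually_atTop.1 hzU
  refine aestronglyMeasurable_of_tendsto_ae atTop
    (f := fun n x => (z (n + N))⁻¹ • (f (k + z (n + N)) x - f k x))
    (fun n => ((hmeas _ (hN _ (Nat.le_add_left N n))).sub (hmeas k hk)).const_smul _) ?_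
  filter_upwards [hdiff] with x hx
  exact (hasDerivAt_iff_tendsto_slope_zero.1
    (hx.differentiableAt (hU.mem_nhds hk)).hasDerivAt).comp (hz.comp (tendsto_add_atTop_nat N))

theorem differentiableOn_integral_of_dominated {bound : α → ℝ} (hU : IsOpen U)
    (hmeas : ∀ k ∈ U, AEStronglyMeasurable (f k) ν)
    (hdiff : ∀ᵐ x ∂ν, DifferentiableOn ℂ (fun k => f k x) U)
    (hbound : ∀ᵐ x ∂ν, ∀ k ∈ U, ‖f k x‖ ≤ bound x) (hint : Integrable bound ν) :
    DifferentiableOn ℂ (fun k => ∫ x, f k x ∂ν) U := by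
  intro k hk
  obtain ⟨r, hr, hrU⟩ := Metric.isOpen_iff.1 hU k hk
  have hball : Metric.ball k (r / 2) ⊆ U := (Metric.ball_subset_ball (by linarith)).trans hrU
  have hcball : ∀ z ∈ Metric.ball k (r / 2), Metric.closedBall z (r / 4) ⊆ U := fun z hz =>
    (Metric.closedBall_subset_ball' (by rw [Metric.mem_ball] at hz; linarith)).trans hrU
  have hcauchy : ∀ᵐ x ∂ν, ∀ z ∈ Metric.ball k (r / 2),
      ‖deriv (fun k => f k x) z‖ ≤ bound x / (r / 4) := by
    filter_upwards [hdiff, hbound] with x hx hb z hz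
    refine Complex.norm_deriv_le_of_forall_mem_sphere_norm_le (by positivity) ?_
      fun w hw => hb w (hcball z hz (Metric.sphere_subset_closedBall hw))
    exact (hx.mono (hcball z hz)).diffContOnCl_ball subset_rfl
  have hderiv : ∀ᵐ x ∂ν, ∀ z ∈ Metric.ball k (r / 2),
      HasDerivAt (fun k => f k x) (deriv (fun k => f k x) z) z := by
    filter_upwards [hdiff] with x hx z hz
    exact (hx.differentiableAt (hU.mem_nhds (hball hz))).hasDerivAt
  have hint_k : Integrable (f k) ν :=
    hint.mono' (hmeas k hk) (by filter_upwards [hbound] with x hx using hx k hk)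
  exact (hasDerivAt_integral_of_dominated_loc_of_deriv_le
    (Metric.ball_mem_nhds k (half_pos hr)) (eventually_of_mem (hU.mem_nhds hk) hmeas) hint_k
    (aestronglyMeasurable_deriv_param hU hmeas hdiff hk) hcauchy (hint.div_const _)
    hderiv).2.differentiableAt.differentiableWithinAt

end HolomorphicIntegral

section TailIntegral

variable {E : Type*} [NormedAddCommGroup E]

theorem setIntegral_Ioi_comp_add_left [NormedSpace ℝ E] (f : ℝ → E) (x : ℝ) :
    ∫ s in Ioi (0 : ℝ), f (x + s) = ∫ t in Ioi x, f t := by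
  simpa using (measurePreserving_add_left volume x).setIntegral_preimage_emb
    (measurableEmbedding_addLeft x) f (Ioi x)

theorem integrableOn_Ioi_comp_add_left_iff {f : ℝ → E} {x : ℝ} :
    IntegrableOn (fun s => f (x + s)) (Ioi 0) ↔ IntegrableOn f (Ioi x) := by
  simpa [Function.comp_def] using (measurePreserving_add_left volume x).integrableOn_comp_preimage
    (measurableEmbedding_addLeft x) (f := f) (s := Ioi x)

theorem hasDerivAt_integral_Ioi [NormedSpace ℝ E] [CompleteSpace E] {f : ℝ → E} {c x : ℝ}
    (hf : ContinuousOn f (Ioi c)) (hi : ∀ y, c < y → IntegrableOn f (Ioi y)) (hx : c < x) :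
    HasDerivAt (fun y => ∫ t in Ioi y, f t) (-f x) x := by
  obtain ⟨y₀, hy₀, hy₀x⟩ := exists_between hx
  have hsplit : (fun y => ∫ t in Ioi y, f t) =ᶠ[𝓝 x]
      fun y => (∫ t in Ioi y₀, f t) - ∫ t in y₀..y, f t := by
    filter_upwards [lt_mem_nhds hy₀x] with y hy
    rw [← intervalIntegral.integral_Ioi_sub_Ioi' (hi y₀ hy₀) (hi y (hy₀.trans hy)),
      sub_sub_cancel]
  have hii : IntervalIntegrable f volume y₀ x :=
    (hf.mono fun t ht => hy₀.trans_le ht.1).intervalIntegrable_of_Icc hy₀x.le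
  exact ((intervalIntegral.integral_hasDerivAt_right hii
    (hf.stronglyMeasurableAtFilter isOpen_Ioi x hx)
    (hf.continuousAt (Ioi_mem_nhds hx))).const_sub _).congr_of_eventuallyEq hsplit

end TailIntegral

section VolterraEquation

/-- The bound `(2 C e^{-x/2})ⁿ / n!` for the `n`-th Picard iterate of a Volterra equation whose
kernel is bounded by `C e^{-(x+s)/2}`. -/
def picardBound (C : ℝ) (n : ℕ) (x : ℝ) : ℝ := (2 * C * Real.exp (-x / 2)) ^ n / n.factorial

theorem picardBound_zero (C x : ℝ) : picardBound C 0 x = 1 := by simp [picardBound]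

theorem picardBound_le_picardBound {C x y : ℝ} (hC : 0 ≤ C) (hxy : x ≤ y) (n : ℕ) :
    picardBound C n y ≤ picardBound C n x := by
  unfold picardBound
  gcongr

theorem hasSum_picardBound (C x : ℝ) :
    HasSum (fun n => picardBound C n x) (Real.exp (2 * C * Real.exp (-x / 2))) := by
  simpa only [picardBound, ← Real.exp_eq_exp_ℝ] using
    NormedSpace.expSeries_div_hasSum_exp (2 * C * Real.exp (-x / 2))

theorem hasDerivAt_picardBound_succ (C : ℝ) (n : ℕ) (x : ℝ) :
    HasDerivAt (picardBound C (n + 1)) (-(C * Real.exp (-x / 2) * picardBound C n x)) x := by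
  have hexp : HasDerivAt (fun x : ℝ => Real.exp (-x / 2)) (Real.exp (-x / 2) * (-1 / 2)) x :=
    (((hasDerivAt_id x).neg).div_const 2).exp
  refine (((hexp.const_mul (2 * C)).pow (n + 1)).div_const _).congr_deriv ?_
  rw [picardBound, Nat.factorial_succ]
  push_cast
  field_simp

theorem tendsto_exp_neg_half : Tendsto (fun x : ℝ => Real.exp (-x / 2)) atTop (𝓝 0) :=
  Real.tendsto_exp_atBot.comp (tendsto_neg_atTop_atBot.atBot_div_const two_pos)

theorem tendsto_picardBound_succ (C : ℝ) (n : ℕ) :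
    Tendsto (picardBound C (n + 1)) atTop (𝓝 0) := by
  have hpow := ((tendsto_exp_neg_half.const_mul (2 * C)).pow (n + 1)).div_const
    ((n + 1).factorial : ℝ)
  rwa [mul_zero, zero_pow n.succ_ne_zero, zero_div] at hpow

theorem integrableOn_mul_picardBound {C : ℝ} (hC : 0 ≤ C) (n : ℕ) (x : ℝ) :
    IntegrableOn (fun s => C * Real.exp (-(x + s) / 2) * picardBound C n (x + s)) (Ioi 0) := by
  rw [integrableOn_Ioi_comp_add_left_iff
    (f := fun t => C * Real.exp (-t / 2) * picardBound C n t)]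
  refine (integrableOn_Ioi_deriv_of_nonpos' (fun t _ => hasDerivAt_picardBound_succ C n t)
    (fun t _ => ?_) (tendsto_picardBound_succ C n)).neg.congr_fun (fun t _ => neg_neg _)
    measurableSet_Ioi
  rw [picardBound, neg_nonpos]
  positivity

theorem integral_mul_picardBound {C : ℝ} (hC : 0 ≤ C) (n : ℕ) (x : ℝ) :
    ∫ s in Ioi (0 : ℝ), C * Real.exp (-(x + s) / 2) * picardBound C n (x + s) =
      picardBound C (n + 1) x := by
  rw [setIntegral_Ioi_comp_add_left (fun t => C * Real.exp (-t / 2) * picardBound C n t),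
    ← neg_inj, ← integral_neg, ← zero_sub (picardBound C (n + 1) x)]
  refine integral_Ioi_of_hasDerivAt_of_nonpos' (fun t _ => hasDerivAt_picardBound_succ C n t)
    (fun t _ => ?_) (tendsto_picardBound_succ C n)
  rw [picardBound, neg_nonpos]
  positivity

theorem integrableOn_const_mul_exp_neg_half {C : ℝ} (hC : 0 ≤ C) (x : ℝ) :
    IntegrableOn (fun s => C * Real.exp (-(x + s) / 2)) (Ioi 0) := by
  simpa only [picardBound_zero, mul_one] using integrableOn_mul_picardBound hC 0 x

theorem integral_const_mul_exp_neg_half {C : ℝ} (hC : 0 ≤ C) (x : ℝ) :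
    ∫ s in Ioi (0 : ℝ), C * Real.exp (-(x + s) / 2) = 2 * C * Real.exp (-x / 2) := by
  simpa [picardBound] using integral_mul_picardBound hC 0 x

variable {E : Type*} [NormedAddCommGroup E] [NormedSpace ℂ E] {P : Type*}

/-- The Picard iterates of the Volterra equation `u(x) = e + ∫₀^∞ M(x, s) u(x + s) ds`, whose
kernel depends on a parameter `k`. -/
def volterraTerm (M : ℝ → ℝ → P → E →L[ℂ] E) (e : E) : ℕ → ℝ → P → E
  | 0, _, _ => e
  | n + 1, x, k => ∫ s in Ioi (0 : ℝ), M x s k (volterraTerm M e n (x + s) k)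

/-- The solution of `u(x) = e + ∫₀^∞ M(x, s) u(x + s) ds` as the sum of the Picard iterates. -/
def volterraSum (M : ℝ → ℝ → P → E →L[ℂ] E) (e : E) (x : ℝ) (k : P) : E :=
  ∑' n, volterraTerm M e n x k

/-- A jointly continuous kernel, for parameters in `D`, with the exponential decay that makes the
Picard series converge on `x > x₀`. -/
structure IsVolterraKernel [TopologicalSpace P] (M : ℝ → ℝ → P → E →L[ℂ] E) (D : Set P)
    (x₀ C : ℝ) : Prop where
  nonneg : 0 ≤ C
  continuousOn : ContinuousOn (fun p : (ℝ × P) × ℝ => M p.1.1 p.2 p.1.2) {p | p.1.2 ∈ D}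
  norm_le : ∀ x, x₀ < x → ∀ s, 0 < s → ∀ k ∈ D, ‖M x s k‖ ≤ C * Real.exp (-(x + s) / 2)

namespace IsVolterraKernel

variable [TopologicalSpace P] {M : ℝ → ℝ → P → E →L[ℂ] E} {D : Set P} {x₀ C x : ℝ} {k : P}

theorem continuousOn_apply (hM : IsVolterraKernel M D x₀ C) {u : ℝ → P → E}
    (hu : ContinuousOn (fun p : ℝ × P => u p.1 p.2) (Ioi x₀ ×ˢ D)) :
    ContinuousOn (fun p : (ℝ × P) × ℝ => M p.1.1 p.2 p.1.2 (u (p.1.1 + p.2) p.1.2))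
      ((Ioi x₀ ×ˢ D) ×ˢ Ioi 0) :=
  (hM.continuousOn.mono fun _ hp => hp.1.2).clm_apply <|
    hu.comp (f := fun p : (ℝ × P) × ℝ => (p.1.1 + p.2, p.1.2)) (by fun_prop)
      fun _ hp => ⟨mem_Ioi.2 (lt_add_of_lt_of_pos hp.1.1 hp.2), hp.1.2⟩

theorem aestronglyMeasurable (hM : IsVolterraKernel M D x₀ C) {u : ℝ → P → E}
    (hu : ContinuousOn (fun p : ℝ × P => u p.1 p.2) (Ioi x₀ ×ˢ D)) (hx : x₀ < x) (hk : k ∈ D) :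
    AEStronglyMeasurable (fun s => M x s k (u (x + s) k)) (volume.restrict (Ioi 0)) :=
  ((hM.continuousOn_apply hu).comp (f := fun s : ℝ => ((x, k), s)) (by fun_prop)
    fun _ hs => ⟨⟨hx, hk⟩, hs⟩).aestronglyMeasurable measurableSet_Ioi

theorem norm_apply_le (hM : IsVolterraKernel M D x₀ C) {s B : ℝ} (hx : x₀ < x) (hs : 0 < s)
    (hk : k ∈ D) {z : E} (hz : ‖z‖ ≤ B) : ‖M x s k z‖ ≤ C * Real.exp (-(x + s) / 2) * B :=
  (M x s k).le_of_opNorm_le_of_le (hM.norm_le x hx s hs k hk) hz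

theorem continuousOn_integral [FirstCountableTopology P] (hM : IsVolterraKernel M D x₀ C)
    {u : ℝ → P → E} (hu : ContinuousOn (fun p : ℝ × P => u p.1 p.2) (Ioi x₀ ×ˢ D)) {B : ℝ}
    (hB : ∀ x, x₀ < x → ∀ k ∈ D, ‖u x k‖ ≤ B) :
    ContinuousOn (fun p : ℝ × P => ∫ s in Ioi (0 : ℝ), M p.1 s p.2 (u (p.1 + s) p.2))
      (Ioi x₀ ×ˢ D) := by
  have hC := hM.nonneg
  refine continuousOn_of_dominated (bound := fun s => C * Real.exp (-(x₀ + s) / 2) * |B|)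
    (fun p hp => hM.aestronglyMeasurable hu hp.1 hp.2) (fun p hp => ?_)
    ((integrableOn_const_mul_exp_neg_half hC x₀).mul_const _) ?_
  · filter_upwards [ae_restrict_mem measurableSet_Ioi] with s (hs : 0 < s)
    have hp₁ : x₀ < p.1 := hp.1
    refine (hM.norm_apply_le hp₁ hs hp.2 ((hB (p.1 + s) (by linarith) p.2 hp.2).trans
      (le_abs_self B))).trans ?_
    gcongr
  · filter_upwards [ae_restrict_mem measurableSet_Ioi] with s hs
    exact (hM.continuousOn_apply hu).comp (f := fun p : ℝ × P => (p, s)) (by fun_prop)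
      fun p hp => ⟨hp, hs⟩

theorem norm_term_le (hM : IsVolterraKernel M D x₀ C) (e : E) (n : ℕ) (hx : x₀ < x)
    (hk : k ∈ D) : ‖volterraTerm M e n x k‖ ≤ picardBound C n x * ‖e‖ := by
  induction n generalizing x with
  | zero => simp [volterraTerm, picardBound_zero]
  | succ n ih =>
    rw [← integral_mul_picardBound hM.nonneg, ← integral_mul_const]
    refine norm_integral_le_of_norm_le
      ((integrableOn_mul_picardBound hM.nonneg n x).mul_const _) ?_
    filter_upwards [ae_restrict_mem measurableSet_Ioi] with s (hs : 0 < s)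
    rw [mul_assoc]
    exact hM.norm_apply_le hx hs hk (ih (by linarith))

theorem norm_term_le_uniform (hM : IsVolterraKernel M D x₀ C) (e : E) (n : ℕ) (hx : x₀ < x)
    (hk : k ∈ D) : ‖volterraTerm M e n x k‖ ≤ picardBound C n x₀ * ‖e‖ :=
  (hM.norm_term_le e n hx hk).trans <|
    mul_le_mul_of_nonneg_right (picardBound_le_picardBound hM.nonneg hx.le n) (norm_nonneg e)

theorem norm_sum_le (hM : IsVolterraKernel M D x₀ C) (e : E) (hx : x₀ < x) (hk : k ∈ D) :
    ‖volterraSum M e x k‖ ≤ Real.exp (2 * C * Real.exp (-x₀ / 2)) * ‖e‖ :=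
  tsum_of_norm_bounded ((hasSum_picardBound C x₀).mul_right ‖e‖)
    fun n => hM.norm_term_le_uniform e n hx hk

theorem norm_apply_sum_le (hM : IsVolterraKernel M D x₀ C) (e : E) {s : ℝ} (hx : x₀ < x)
    (hs : 0 < s) (hk : k ∈ D) :
    ‖M x s k (volterraSum M e (x + s) k)‖ ≤
      C * Real.exp (-(x + s) / 2) * (Real.exp (2 * C * Real.exp (-x₀ / 2)) * ‖e‖) :=
  hM.norm_apply_le hx hs hk (hM.norm_sum_le e (by linarith) hk)

theorem continuousOn_term [FirstCountableTopology P] (hM : IsVolterraKernel M D x₀ C) (e : E)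
    (n : ℕ) : ContinuousOn (fun p : ℝ × P => volterraTerm M e n p.1 p.2) (Ioi x₀ ×ˢ D) := by
  induction n with
  | zero => exact continuousOn_const
  | succ n ih => exact hM.continuousOn_integral ih fun x hx k hk =>
      hM.norm_term_le_uniform e n hx hk

theorem differentiableOn_term {M : ℝ → ℝ → ℂ → E →L[ℂ] E} {D U : Set ℂ}
    (hM : IsVolterraKernel M D x₀ C) (e : E) (hU : IsOpen U) (hUD : U ⊆ D)
    (hd : ∀ x s, DifferentiableOn ℂ (M x s) U) (n : ℕ) (hx : x₀ < x) :
    DifferentiableOn ℂ (fun k => volterraTerm M e n x k) U := by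
  induction n generalizing x with
  | zero => exact differentiableOn_const _
  | succ n ih =>
    refine differentiableOn_integral_of_dominated
      (bound := fun s => C * Real.exp (-(x + s) / 2) * (picardBound C n x₀ * ‖e‖)) hU
      (fun k hk => hM.aestronglyMeasurable (hM.continuousOn_term e n) hx (hUD hk)) ?_ ?_
      ((integrableOn_const_mul_exp_neg_half hM.nonneg x).mul_const _)
    · filter_upwards [ae_restrict_mem measurableSet_Ioi] with s (hs : 0 < s)
      exact (hd x s).clm_apply (ih (by linarith))
    · filter_upwards [ae_restrict_mem measurableSet_Ioi] with s (hs : 0 < s) k hk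
      exact hM.norm_apply_le hx hs (hUD hk) (hM.norm_term_le_uniform e n (by linarith) (hUD hk))

variable [CompleteSpace E]

theorem continuousOn_sum [FirstCountableTopology P] (hM : IsVolterraKernel M D x₀ C) (e : E) :
    ContinuousOn (fun p : ℝ × P => volterraSum M e p.1 p.2) (Ioi x₀ ×ˢ D) :=
  continuousOn_tsum (hM.continuousOn_term e) ((hasSum_picardBound C x₀).mul_right ‖e‖).summable
    fun n _ hp => hM.norm_term_le_uniform e n hp.1 hp.2

theorem integrableOn_sum [FirstCountableTopology P] (hM : IsVolterraKernel M D x₀ C) (e : E)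
    (hx : x₀ < x) (hk : k ∈ D) :
    IntegrableOn (fun s => M x s k (volterraSum M e (x + s) k)) (Ioi 0) := by
  refine Integrable.mono'
    ((integrableOn_const_mul_exp_neg_half hM.nonneg x).mul_const
      (Real.exp (2 * C * Real.exp (-x₀ / 2)) * ‖e‖))
    (hM.aestronglyMeasurable (hM.continuousOn_sum e) hx hk) ?_
  filter_upwards [ae_restrict_mem measurableSet_Ioi] with s hs
  exact hM.norm_apply_sum_le e hx hs hk

theorem differentiableOn_sum {M : ℝ → ℝ → ℂ → E →L[ℂ] E} {D U : Set ℂ}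
    (hM : IsVolterraKernel M D x₀ C) (e : E) (hU : IsOpen U) (hUD : U ⊆ D)
    (hd : ∀ x s, DifferentiableOn ℂ (M x s) U) (hx : x₀ < x) :
    DifferentiableOn ℂ (fun k => volterraSum M e x k) U :=
  Complex.differentiableOn_tsum_of_summable_norm
    ((hasSum_picardBound C x₀).mul_right ‖e‖).summable
    (fun n => hM.differentiableOn_term e hU hUD hd n hx) hU
    fun n _ hk => hM.norm_term_le_uniform e n hx (hUD hk)

theorem hasSum_term (hM : IsVolterraKernel M D x₀ C) (e : E) (hx : x₀ < x) (hk : k ∈ D) :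
    HasSum (fun n => volterraTerm M e n x k) (volterraSum M e x k) :=
  (Summable.of_norm_bounded ((hasSum_picardBound C x₀).mul_right ‖e‖).summable
    fun n => hM.norm_term_le_uniform e n hx hk).hasSum

theorem sum_eq [FirstCountableTopology P] (hM : IsVolterraKernel M D x₀ C) (e : E)
    (hx : x₀ < x) (hk : k ∈ D) :
    volterraSum M e x k = e + ∫ s in Ioi (0 : ℝ), M x s k (volterraSum M e (x + s) k) := by
  have hbound := (hasSum_picardBound C x₀).mul_right ‖e‖
  have hintegral : HasSum (fun n => volterraTerm M e (n + 1) x k)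
      (∫ s in Ioi (0 : ℝ), M x s k (volterraSum M e (x + s) k)) := by
    refine hasSum_integral_of_dominated_convergence
      (fun n s => C * Real.exp (-(x + s) / 2) * (picardBound C n x₀ * ‖e‖))
      (fun n => hM.aestronglyMeasurable (hM.continuousOn_term e n) hx hk) (fun n => ?_)
      (Eventually.of_forall fun s => hbound.summable.mul_left _) ?_ ?_
    · filter_upwards [ae_restrict_mem measurableSet_Ioi] with s (hs : 0 < s)
      exact hM.norm_apply_le hx hs hk (hM.norm_term_le_uniform e n (by linarith) hk)
    · simp_rw [tsum_mul_left]
      exact (integrableOn_const_mul_exp_neg_half hM.nonneg x).mul_const _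
    · filter_upwards [ae_restrict_mem measurableSet_Ioi] with s (hs : 0 < s)
      exact (M x s k).hasSum (hM.hasSum_term e (by linarith) hk)
  rw [volterraSum, (hM.hasSum_term e hx hk).summable.tsum_eq_zero_add, hintegral.tsum_eq]
  rfl

theorem norm_sum_sub_le [FirstCountableTopology P] (hM : IsVolterraKernel M D x₀ C) (e : E)
    (hx : x₀ < x) (hk : k ∈ D) :
    ‖volterraSum M e x k - e‖ ≤
      2 * C * Real.exp (-x / 2) * (Real.exp (2 * C * Real.exp (-x₀ / 2)) * ‖e‖) := by
  rw [hM.sum_eq e hx hk, add_sub_cancel_left, ← integral_const_mul_exp_neg_half hM.nonneg,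
    ← integral_mul_const]
  refine norm_integral_le_of_norm_le
    ((integrableOn_const_mul_exp_neg_half hM.nonneg x).mul_const _) ?_
  filter_upwards [ae_restrict_mem measurableSet_Ioi] with s hs
  exact hM.norm_apply_sum_le e hx hs hk

theorem tendstoUniformlyOn_sum [FirstCountableTopology P] (hM : IsVolterraKernel M D x₀ C)
    (e : E) : TendstoUniformlyOn (volterraSum M e) (fun _ => e) atTop D := by
  rw [Metric.tendstoUniformlyOn_iff]
  intro ε hε
  have hsmall : Tendsto (fun x => 2 * C * Real.exp (-x / 2) *
      (Real.exp (2 * C * Real.exp (-x₀ / 2)) * ‖e‖)) atTop (𝓝 0) := by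
    simpa using (tendsto_exp_neg_half.const_mul (2 * C)).mul_const
      (Real.exp (2 * C * Real.exp (-x₀ / 2)) * ‖e‖)
  filter_upwards [hsmall.eventually (gt_mem_nhds hε), eventually_gt_atTop x₀] with x hxε hx k hk
  rw [dist_comm, dist_eq_norm]
  exact (hM.norm_sum_sub_le e hx hk).trans_lt hxε

/-- The factorization of `ℓ ∘ M(x, s)` turns the Volterra equation for `ℓ ∘ u` into
`ℓ u(x) = ℓ e + g(x) ∫ₓ^∞ N(t) u(t) dt`. -/
theorem hasDerivAt_clm_sum [FirstCountableTopology P] {F : Type*} [NormedAddCommGroup F]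
    [NormedSpace ℂ F] [CompleteSpace F] (hM : IsVolterraKernel M D x₀ C) (e : E)
    (ℓ : E →L[ℂ] F) {g : ℝ → ℂ} {g' : ℂ} {N : ℝ → E →L[ℂ] F} (hg₀ : ∀ y, g y ≠ 0)
    (hN : ContinuousOn N (Ioi x₀)) (hk : k ∈ D)
    (hfac : ∀ y s z, x₀ < y → 0 ≤ s → ℓ (M y s k z) = g y • N (y + s) z) (hx : x₀ < x)
    (hg : HasDerivAt g g' x) :
    HasDerivAt (fun y => ℓ (volterraSum M e y k))
      ((g' / g x) • (ℓ (volterraSum M e x k) - ℓ e) - ℓ (M x 0 k (volterraSum M e x k))) x := by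
  set h : ℝ → F := fun t => N t (volterraSum M e t k)
  have hfac_sum : ∀ y, x₀ < y → ∀ s, 0 < s →
      ℓ (M y s k (volterraSum M e (y + s) k)) = g y • h (y + s) :=
    fun y hy s hs => hfac y s _ hy hs.le
  have hcont : ContinuousOn h (Ioi x₀) := hN.clm_apply <|
    (hM.continuousOn_sum e).comp (f := fun t => (t, k)) (by fun_prop) fun t ht => ⟨ht, hk⟩
  have hint : ∀ y, x₀ < y → IntegrableOn h (Ioi y) := fun y hy => by
    refine integrableOn_Ioi_comp_add_left_iff.1 <|
      ((ℓ.integrable_comp (hM.integrableOn_sum e hy hk)).smul (g y)⁻¹).congr ?_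
    filter_upwards [ae_restrict_mem measurableSet_Ioi] with s hs
    simp only [Pi.smul_apply, hfac_sum y hy s hs, inv_smul_smul₀ (hg₀ y)]
  have hsum : ∀ y, x₀ < y → ℓ (volterraSum M e y k) = ℓ e + g y • ∫ t in Ioi y, h t := by
    intro y hy
    rw [hM.sum_eq e hy hk, map_add, ← ℓ.integral_comp_comm (hM.integrableOn_sum e hy hk),
      setIntegral_congr_fun measurableSet_Ioi (hfac_sum y hy), integral_smul,
      setIntegral_Ioi_comp_add_left h]
  refine (((hg.smul (hasDerivAt_integral_Ioi hcont hint hx)).const_add (ℓ e)).congr_of_eventuallyEq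
    (eventually_of_mem (Ioi_mem_nhds hx) hsum)).congr_deriv ?_
  have hdiag : ℓ (M x 0 k (volterraSum M e x k)) = g x • h x := by
    simpa only [add_zero] using hfac x 0 (volterraSum M e x k) hx le_rfl
  rw [hdiag, hsum x hx, add_sub_cancel_left, smul_smul, div_mul_cancel₀ _ (hg₀ x), smul_neg]
  abel

end IsVolterraKernel

end VolterraEquation

section LinearSystem

variable {E : Type*} [NormedAddCommGroup E] [NormedSpace ℂ E] {A : ℝ → E →L[ℂ] E}

/-- The substitution `ξ = e^{-x/2}` turns the initial value problem `V' = A(ξ) V`, `V(0+) = e`, into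
the Volterra equation with this kernel. -/
def logTimeKernel (A : ℝ → E →L[ℂ] E) (x s : ℝ) (_ : Unit) : E →L[ℂ] E :=
  ((Real.exp (-(x + s) / 2) / 2 : ℝ) : ℂ) • A (Real.exp (-(x + s) / 2))

theorem exists_isVolterraKernel_logTimeKernel (hA : Continuous A) (x₀ : ℝ) :
    ∃ C, IsVolterraKernel (logTimeKernel A) univ x₀ C := by
  obtain ⟨C, hC⟩ := isCompact_Icc.exists_bound_of_continuousOn
    (hA.continuousOn (s := Icc 0 (Real.exp (-x₀ / 2))))
  have hC₀ : 0 ≤ C := (norm_nonneg _).trans (hC 0 ⟨le_rfl, (Real.exp_pos _).le⟩)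
  refine ⟨C, hC₀, Continuous.continuousOn (by unfold logTimeKernel; fun_prop),
    fun x hx s hs _ _ => ?_⟩
  rw [logTimeKernel, norm_smul, Complex.norm_real, Real.norm_of_nonneg (by positivity), mul_comm C]
  have hexp := Real.exp_pos (-(x + s) / 2)
  have hAC := hC (Real.exp (-(x + s) / 2)) ⟨hexp.le, Real.exp_le_exp.2 (by linarith)⟩
  exact mul_le_mul (half_le_self hexp.le) hAC (norm_nonneg _) hexp.le

theorem hasDerivAt_volterraSum_logTimeKernel [CompleteSpace E] (hA : Continuous A) (e : E)
    (x : ℝ) :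
    HasDerivAt (fun y => volterraSum (logTimeKernel A) e y ())
      (-logTimeKernel A x 0 () (volterraSum (logTimeKernel A) e x ())) x := by
  obtain ⟨C, hM⟩ := exists_isVolterraKernel_logTimeKernel hA (x - 1)
  have hN : Continuous fun t => logTimeKernel A t 0 () := by unfold logTimeKernel; fun_prop
  simpa using hM.hasDerivAt_clm_sum e (ContinuousLinearMap.id ℂ E) (fun _ => one_ne_zero)
    hN.continuousOn (mem_univ ()) (fun y s z _ _ => by simp [logTimeKernel]) (sub_one_lt x)
    (hasDerivAt_const x (1 : ℂ))

theorem exists_linear_system_solution [CompleteSpace E] (hA : Continuous A) (e : E) :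
    ∃ V : ℝ → E, (∀ ξ, 0 < ξ → HasDerivAt V (A ξ (V ξ)) ξ) ∧ Tendsto V (𝓝[>] 0) (𝓝 e) := by
  set u : ℝ → E := fun x => volterraSum (logTimeKernel A) e x ()
  refine ⟨fun ξ => u (-2 * Real.log ξ), fun ξ hξ => ?_, ?_⟩
  · have hexp : Real.exp (-(-2 * Real.log ξ + 0) / 2) = ξ := by
      rw [show -(-2 * Real.log ξ + 0) / 2 = Real.log ξ by ring, Real.exp_log hξ]
    refine ((hasDerivAt_volterraSum_logTimeKernel hA e (-2 * Real.log ξ)).scomp ξ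
      ((Real.hasDerivAt_log hξ.ne').const_mul (-2))).congr_deriv ?_
    rw [logTimeKernel, hexp, smul_apply, smul_neg, ← neg_smul,
      Complex.coe_smul, smul_smul]
    convert one_smul ℝ (A ξ (u (-2 * Real.log ξ))) using 2
    field_simp
  · obtain ⟨C, hM⟩ := exists_isVolterraKernel_logTimeKernel hA 0
    exact ((hM.tendstoUniformlyOn_sum e).tendsto_at (mem_univ ())).comp
      (Real.tendsto_log_nhdsGT_zero.const_mul_atBot_of_neg (by norm_num))

end LinearSystem

section SecondOrderEquation

/-- `v` solves `v'' + Q v = 0` on `(0, ∞)` and `v'` is its derivative. -/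
def IsSolutionPair (Q : ℝ → ℂ) (v v' : ℝ → ℂ) : Prop :=
  ∀ ξ : ℝ, 0 < ξ → HasDerivAt v (v' ξ) ξ ∧ HasDerivAt v' (-(Q ξ * v ξ)) ξ

/-- The Wronskian of two functions with derivatives `v'` and `w'`. -/
def wronskian (v v' w w' : ℝ → ℂ) (ξ : ℝ) : ℂ := v ξ * w' ξ - v' ξ * w ξ

variable {Q : ℝ → ℂ} {v v' w w' : ℝ → ℂ}

theorem exists_isSolutionPair (hQ : Continuous Q) (a b : ℂ) :
    ∃ v v' : ℝ → ℂ, IsSolutionPair Q v v' ∧ Tendsto v (𝓝[>] 0) (𝓝 a) ∧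
      Tendsto v' (𝓝[>] 0) (𝓝 b) := by
  obtain ⟨V, hV, hV₀⟩ := exists_linear_system_solution
    (A := fun ξ => (ContinuousLinearMap.inl ℂ ℂ ℂ).comp (ContinuousLinearMap.snd ℂ ℂ ℂ) -
      Q ξ • (ContinuousLinearMap.inr ℂ ℂ ℂ).comp (ContinuousLinearMap.fst ℂ ℂ ℂ))
    (by fun_prop) (a, b)
  refine ⟨fun ξ => (V ξ).1, fun ξ => (V ξ).2, fun ξ hξ => ⟨?_, ?_⟩,
    (continuous_fst.tendsto _).comp hV₀, (continuous_snd.tendsto _).comp hV₀⟩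
  · simpa [Function.comp_def] using
      (ContinuousLinearMap.fst ℝ ℂ ℂ).hasFDerivAt.comp_hasDerivAt ξ (hV ξ hξ)
  · simpa [Function.comp_def] using
      (ContinuousLinearMap.snd ℝ ℂ ℂ).hasFDerivAt.comp_hasDerivAt ξ (hV ξ hξ)

namespace IsSolutionPair

theorem const_mul (hv : IsSolutionPair Q v v') (c : ℂ) :
    IsSolutionPair Q (fun ξ => c * v ξ) (fun ξ => c * v' ξ) := fun ξ hξ =>
  ⟨(hv ξ hξ).1.const_mul c, ((hv ξ hξ).2.const_mul c).congr_deriv (by ring)⟩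

theorem sub (hv : IsSolutionPair Q v v') (hw : IsSolutionPair Q w w') :
    IsSolutionPair Q (fun ξ => v ξ - w ξ) (fun ξ => v' ξ - w' ξ) := fun ξ hξ =>
  ⟨(hv ξ hξ).1.sub (hw ξ hξ).1, ((hv ξ hξ).2.sub (hw ξ hξ).2).congr_deriv (by ring)⟩

theorem exists_wronskian_eq (hv : IsSolutionPair Q v v') (hw : IsSolutionPair Q w w') :
    ∃ c : ℂ, ∀ ξ, 0 < ξ → wronskian v v' w w' ξ = c := by
  have hderiv : ∀ ξ ∈ Ioi (0 : ℝ), HasDerivAt (wronskian v v' w w') 0 ξ := fun ξ hξ =>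
    (((hv ξ hξ).1.mul (hw ξ hξ).2).sub ((hv ξ hξ).2.mul (hw ξ hξ).1)).congr_deriv (by ring)
  exact isOpen_Ioi.exists_is_const_of_deriv_eq_zero isPreconnected_Ioi
    (fun ξ hξ => (hderiv ξ hξ).differentiableAt.differentiableWithinAt)
    fun ξ hξ => (hderiv ξ hξ).deriv

theorem hasDerivAt_div (hv : IsSolutionPair Q v v') (hw : IsSolutionPair Q w w') {ξ : ℝ}
    (hξ : 0 < ξ) (hvξ : v ξ ≠ 0) :
    HasDerivAt (fun ξ => w ξ / v ξ) (wronskian v v' w w' ξ / v ξ ^ 2) ξ :=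
  ((hw ξ hξ).1.div (hv ξ hξ).1 hvξ).congr_deriv (by rw [wronskian]; ring)

theorem exists_fundamental_pair (hQ : Continuous Q) :
    ∃ f f' g g' : ℝ → ℂ, IsSolutionPair Q f f' ∧ IsSolutionPair Q g g' ∧
      ∀ ξ, 0 < ξ → wronskian f f' g g' ξ = 1 := by
  obtain ⟨f, f', hf, hf₀, hf₀'⟩ := exists_isSolutionPair hQ 1 0
  obtain ⟨g, g', hg, hg₀, hg₀'⟩ := exists_isSolutionPair hQ 0 1
  obtain ⟨c, hc⟩ := hf.exists_wronskian_eq hg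
  have hlim : Tendsto (wronskian f f' g g') (𝓝[>] 0) (𝓝 (1 * 1 - 0 * 0)) :=
    (hf₀.mul hg₀').sub (hf₀'.mul hg₀)
  have hconst : Tendsto (wronskian f f' g g') (𝓝[>] 0) (𝓝 c) :=
    tendsto_nhdsWithin_congr (fun ξ hξ => (hc ξ hξ).symm) tendsto_const_nhds
  have hc₁ : c = 1 := by simpa using tendsto_nhds_unique hconst hlim
  exact ⟨f, f', g, g', hf, hg, hc₁ ▸ hc⟩

theorem exists_wronskian_eq_one (hQ : Continuous Q) (hv : IsSolutionPair Q v v') {ξ₀ : ℝ}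
    (hξ₀ : 0 < ξ₀) (hvξ₀ : v ξ₀ ≠ 0) :
    ∃ w w' : ℝ → ℂ, IsSolutionPair Q w w' ∧ ∀ ξ, 0 < ξ → wronskian v v' w w' ξ = 1 := by
  suffices h : ∃ w w' : ℝ → ℂ, IsSolutionPair Q w w' ∧ wronskian v v' w w' ξ₀ ≠ 0 by
    obtain ⟨w, w', hw, hne⟩ := h
    obtain ⟨c, hc⟩ := hv.exists_wronskian_eq hw
    refine ⟨_, _, hw.const_mul c⁻¹, fun ξ hξ => ?_⟩
    have hc₀ : c ≠ 0 := hc ξ₀ hξ₀ ▸ hne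
    rw [← inv_mul_cancel₀ hc₀, ← hc ξ hξ, wronskian, wronskian]
    ring
  obtain ⟨f, f', g, g', hf, hg, hfg⟩ := exists_fundamental_pair hQ
  by_contra! hall
  have hvf := hall f f' hf
  have hvg := hall g g' hg
  have hone := hfg ξ₀ hξ₀
  simp only [wronskian] at hvf hvg hone
  exact hvξ₀ (by linear_combination -v ξ₀ * hone + f ξ₀ * hvg - g ξ₀ * hvf)

end IsSolutionPair

end SecondOrderEquation

section Comparison

/-- The coefficient of the radial equation `v'' + Q v = 0`. -/
def radialCoeff (Z : ℝ) (μ k : ℂ) (ξ : ℝ) : ℂ :=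
  k ^ 2 * (Real.cosh ξ : ℂ) ^ 2 + (Z : ℂ) * (Real.cosh ξ : ℂ) - μ

/-- The phase `ψ(ξ, k)` of the comparison function: the growing terms of the Liouville–Green phase
`∫ √(k² cosh² + Z cosh - μ)`. -/
def phase (Z ξ : ℝ) (k : ℂ) : ℂ := k * (Real.sinh ξ : ℂ) + (Z : ℂ) * (ξ : ℂ) / (2 * k)

/-- The `ξ`-derivative of the comparison phase. -/
def phaseDeriv (Z ξ : ℝ) (k : ℂ) : ℂ := k * (Real.cosh ξ : ℂ) + (Z : ℂ) / (2 * k)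

/-- The Liouville–Green comparison function `(cosh ξ)^{-1/2} exp(i ψ(ξ, k))`. -/
def comparison (Z ξ : ℝ) (k : ℂ) : ℂ :=
  (((Real.sqrt (Real.cosh ξ))⁻¹ : ℝ) : ℂ) * Complex.exp (Complex.I * phase Z ξ k)

/-- The logarithmic derivative of the comparison function. -/
def comparisonLogDeriv (Z ξ : ℝ) (k : ℂ) : ℂ :=
  -((Real.sinh ξ : ℂ) / (2 * (Real.cosh ξ : ℂ))) + Complex.I * phaseDeriv Z ξ k

/-- The residual `y'' / y + (k² cosh² ξ + Z cosh ξ - μ)` of the comparison function `y`. -/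
def residual (Z : ℝ) (μ : ℂ) (ξ : ℝ) (k : ℂ) : ℂ :=
  (Real.tanh ξ : ℂ) ^ 2 / 4 - 1 / (2 * (Real.cosh ξ : ℂ) ^ 2)
    - Complex.I * (Z : ℂ) / (2 * k) * (Real.tanh ξ : ℂ) - (Z : ℂ) ^ 2 / (4 * k ^ 2) - μ

theorem radialCoeff_neg (Z : ℝ) (μ k : ℂ) : radialCoeff Z μ (-k) = radialCoeff Z μ k := by
  ext ξ
  simp only [radialCoeff, neg_sq]

theorem continuous_radialCoeff (Z : ℝ) (μ k : ℂ) : Continuous (radialCoeff Z μ k) := by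
  unfold radialCoeff
  fun_prop

theorem phase_neg (Z ξ : ℝ) (k : ℂ) : phase Z ξ (-k) = -phase Z ξ k := by
  simp only [phase, mul_neg, neg_mul, div_neg, neg_add]

theorem comparison_ne_zero (Z ξ : ℝ) (k : ℂ) : comparison Z ξ k ≠ 0 :=
  mul_ne_zero (Complex.ofReal_ne_zero.2 (inv_ne_zero (Real.sqrt_pos.2 (Real.cosh_pos ξ)).ne'))
    (Complex.exp_ne_zero _)

theorem ofReal_cosh_ne_zero (ξ : ℝ) : (Real.cosh ξ : ℂ) ≠ 0 :=
  Complex.ofReal_ne_zero.2 (Real.cosh_pos ξ).ne'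

theorem hasDerivAt_ofReal_cosh (ξ : ℝ) :
    HasDerivAt (fun ξ : ℝ => (Real.cosh ξ : ℂ)) (Real.sinh ξ : ℂ) ξ :=
  (Real.hasDerivAt_cosh ξ).ofReal_comp

theorem hasDerivAt_ofReal_sinh (ξ : ℝ) :
    HasDerivAt (fun ξ : ℝ => (Real.sinh ξ : ℂ)) (Real.cosh ξ : ℂ) ξ :=
  (Real.hasDerivAt_sinh ξ).ofReal_comp

theorem hasDerivAt_phase (Z ξ : ℝ) (k : ℂ) :
    HasDerivAt (fun ξ => phase Z ξ k) (phaseDeriv Z ξ k) ξ := by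
  have hlinear : HasDerivAt (fun ξ : ℝ => (Z : ℂ) * (ξ : ℂ) / (2 * k)) ((Z : ℂ) / (2 * k)) ξ := by
    simpa using ((hasDerivAt_id ξ).ofReal_comp.const_mul (Z : ℂ)).div_const (2 * k)
  exact ((hasDerivAt_ofReal_sinh ξ).const_mul k).add hlinear

theorem hasDerivAt_inv_sqrt_cosh (ξ : ℝ) :
    HasDerivAt (fun ξ => (Real.sqrt (Real.cosh ξ))⁻¹)
      ((Real.sqrt (Real.cosh ξ))⁻¹ * -(Real.sinh ξ / (2 * Real.cosh ξ))) ξ := by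
  have hc := Real.cosh_pos ξ
  have hs := (Real.sqrt_pos.2 hc).ne'
  refine (((Real.hasDerivAt_cosh ξ).sqrt hc.ne').inv hs).congr_deriv ?_
  field_simp
  rw [Real.sq_sqrt hc.le]

theorem hasDerivAt_comparison (Z ξ : ℝ) (k : ℂ) :
    HasDerivAt (fun ξ => comparison Z ξ k) (comparison Z ξ k * comparisonLogDeriv Z ξ k) ξ := by
  refine ((hasDerivAt_inv_sqrt_cosh ξ).ofReal_comp.mul
    ((hasDerivAt_phase Z ξ k).const_mul Complex.I).cexp).congr_deriv ?_
  simp only [comparison, comparisonLogDeriv]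
  push_cast
  ring

/-- The Riccati equation of the comparison function, which defines the residual. -/
theorem hasDerivAt_comparisonLogDeriv (Z : ℝ) (μ : ℂ) (ξ : ℝ) {k : ℂ} (hk : k ≠ 0) :
    HasDerivAt (fun ξ => comparisonLogDeriv Z ξ k)
      (residual Z μ ξ k - radialCoeff Z μ k ξ - comparisonLogDeriv Z ξ k ^ 2) ξ := by
  have hc := ofReal_cosh_ne_zero ξ
  refine (((hasDerivAt_ofReal_sinh ξ).div ((hasDerivAt_ofReal_cosh ξ).const_mul 2)
    (mul_ne_zero two_ne_zero hc)).neg.add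
    ((((hasDerivAt_ofReal_cosh ξ).const_mul k).add_const _).const_mul Complex.I)).congr_deriv ?_
  have hsinh_sq : (Real.sinh ξ : ℂ) ^ 2 = (Real.cosh ξ : ℂ) ^ 2 - 1 := by
    exact_mod_cast Real.sinh_sq ξ
  simp only [residual, radialCoeff, comparisonLogDeriv, phaseDeriv, Real.tanh_eq_sinh_div_cosh,
    Complex.ofReal_div]
  generalize (Real.sinh ξ : ℂ) = S at *
  generalize (Real.cosh ξ : ℂ) = c at *
  field_simp
  ring_nf
  simp only [Complex.I_sq, hsinh_sq]
  ring

theorem isSolutionPair_comparison_mul {Z : ℝ} {μ k : ℂ} (hk : k ≠ 0) {m b : ℝ → ℂ}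
    (hm : ∀ ξ, 0 < ξ → HasDerivAt m ((Real.cosh ξ : ℂ) * b ξ) ξ)
    (hb : ∀ ξ, 0 < ξ → HasDerivAt b (-2 * Complex.I * phaseDeriv Z ξ k * b ξ -
      residual Z μ ξ k / (Real.cosh ξ : ℂ) * m ξ) ξ) :
    IsSolutionPair (radialCoeff Z μ k) (fun ξ => comparison Z ξ k * m ξ)
      (fun ξ => comparison Z ξ k * (comparisonLogDeriv Z ξ k * m ξ + (Real.cosh ξ : ℂ) * b ξ)) := by
  intro ξ hξ
  have hc := ofReal_cosh_ne_zero ξ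
  refine ⟨((hasDerivAt_comparison Z ξ k).mul (hm ξ hξ)).congr_deriv (by ring), ?_⟩
  refine ((hasDerivAt_comparison Z ξ k).mul
    (((hasDerivAt_comparisonLogDeriv Z μ ξ hk).mul (hm ξ hξ)).add
      ((hasDerivAt_ofReal_cosh ξ).mul (hb ξ hξ)))).congr_deriv ?_
  have htwice : 2 * (Real.cosh ξ : ℂ) * comparisonLogDeriv Z ξ k =
      -(Real.sinh ξ : ℂ) + 2 * Complex.I * (Real.cosh ξ : ℂ) * phaseDeriv Z ξ k := by
    rw [comparisonLogDeriv]
    field_simp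
  have hres : (Real.cosh ξ : ℂ) * (residual Z μ ξ k / (Real.cosh ξ : ℂ)) = residual Z μ ξ k :=
    mul_div_cancel₀ _ hc
  simp only [Pi.add_apply, Pi.mul_apply]
  linear_combination comparison Z ξ k * b ξ * htwice - comparison Z ξ k * m ξ * hres

end Comparison

section Kernel

variable {Z ξ t δ : ℝ} {μ k : ℂ}

theorem im_phase (Z ξ : ℝ) (k : ℂ) :
    (phase Z ξ k).im = k.im * (Real.sinh ξ - Z / (2 * ‖k‖ ^ 2) * ξ) := by
  have hquotient : (Z : ℂ) * (ξ : ℂ) / (2 * k) = ((Z * ξ / 2 : ℝ) : ℂ) * k⁻¹ := by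
    push_cast
    ring
  rw [phase, hquotient, Complex.add_im, Complex.im_mul_ofReal, Complex.im_ofReal_mul,
    Complex.inv_im, Complex.normSq_eq_norm_sq]
  ring

theorem sq_div_four_le_sinh {x : ℝ} (hx : 0 ≤ x) : x ^ 2 / 4 ≤ Real.sinh x := by
  rw [Real.sinh_eq]
  linarith [Real.quadratic_le_exp_of_nonneg hx, Real.exp_le_one_iff.2 (neg_nonpos.2 hx)]

theorem two_mul_sinh_half_sub_le (h : ξ ≤ t) :
    2 * Real.sinh ((t - ξ) / 2) ≤ Real.sinh t - Real.sinh ξ := by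
  have hdiff : Real.sinh t - Real.sinh ξ =
      2 * Real.cosh ((t + ξ) / 2) * Real.sinh ((t - ξ) / 2) := by
    conv_lhs => rw [show t = (t + ξ) / 2 + (t - ξ) / 2 by ring,
      show ξ = (t + ξ) / 2 - (t - ξ) / 2 by ring]
    simp only [Real.sinh_add, Real.sinh_sub]
    ring_nf
  rw [hdiff]
  refine mul_le_mul_of_nonneg_right ?_ (Real.sinh_nonneg_iff.2 (by linarith))
  linarith [Real.one_le_cosh ((t + ξ) / 2)]

theorem neg_le_im_phase_sub (hδ : 0 < δ) (hk : 0 ≤ k.im) (hkδ : δ ≤ ‖k‖) (h : ξ ≤ t) :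
    -(Z ^ 2 / (2 * δ ^ 3)) ≤ (phase Z t k - phase Z ξ k).im := by
  have hk₀ : 0 < ‖k‖ := hδ.trans_le hkδ
  set β := Z / (2 * ‖k‖ ^ 2) with hβ
  -- The quadratic lower bound of `sinh` absorbs the term of `ψ` that is linear in `ξ`.
  have hsquare : -(2 * β ^ 2) ≤ (Real.sinh t - Real.sinh ξ) - β * (t - ξ) := by
    nlinarith [two_mul_sinh_half_sub_le h, sq_nonneg ((t - ξ) / 2 - 2 * β),
      sq_div_four_le_sinh (x := (t - ξ) / 2) (by linarith)]
  have hbound : k.im * (2 * β ^ 2) ≤ Z ^ 2 / (2 * δ ^ 3) := by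
    calc k.im * (2 * β ^ 2) ≤ ‖k‖ * (2 * β ^ 2) := by
          gcongr
          exact (le_abs_self _).trans (Complex.abs_im_le_norm k)
      _ = Z ^ 2 / (2 * ‖k‖ ^ 3) := by rw [hβ]; field_simp
      _ ≤ Z ^ 2 / (2 * δ ^ 3) := by gcongr
  rw [Complex.sub_im, im_phase, im_phase]
  nlinarith [mul_le_mul_of_nonneg_left hsquare hk]

theorem norm_exp_two_I_mul (z : ℂ) :
    ‖Complex.exp (2 * Complex.I * z)‖ = Real.exp (-2 * z.im) := by
  rw [Complex.norm_exp]
  simp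

theorem norm_exp_phase_sub_le (hδ : 0 < δ) (hk : 0 ≤ k.im) (hkδ : δ ≤ ‖k‖) (h : ξ ≤ t) :
    ‖Complex.exp (2 * Complex.I * (phase Z t k - phase Z ξ k))‖ ≤ Real.exp (Z ^ 2 / δ ^ 3) := by
  have hdouble : Z ^ 2 / δ ^ 3 = 2 * (Z ^ 2 / (2 * δ ^ 3)) := by field_simp
  rw [norm_exp_two_I_mul, Real.exp_le_exp, hdouble]
  linarith [neg_le_im_phase_sub (Z := Z) hδ hk hkδ h]

/-- A bound for the residual that is uniform in `ξ` and in `‖k‖ ≥ δ`. -/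
def residualBound (Z : ℝ) (μ : ℂ) (δ : ℝ) : ℝ :=
  1 / 4 + 1 / 2 + |Z| / (2 * δ) + Z ^ 2 / (4 * δ ^ 2) + ‖μ‖

theorem residualBound_nonneg (Z : ℝ) (μ : ℂ) (hδ : 0 < δ) : 0 ≤ residualBound Z μ δ := by
  unfold residualBound
  positivity

theorem norm_residual_le (Z : ℝ) (μ : ℂ) (ξ : ℝ) (hδ : 0 < δ) (hk : δ ≤ ‖k‖) :
    ‖residual Z μ ξ k‖ ≤ residualBound Z μ δ := by
  have htanh : |Real.tanh ξ| ≤ 1 :=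
    abs_le.2 ⟨(Real.neg_one_lt_tanh ξ).le, (Real.tanh_lt_one ξ).le⟩
  have htanh_sq : ‖(Real.tanh ξ : ℂ) ^ 2 / 4‖ ≤ 1 / 4 := by
    rw [norm_div, norm_pow, Complex.norm_real, Real.norm_eq_abs, Complex.norm_ofNat]
    gcongr
    exact pow_le_one₀ (abs_nonneg _) htanh
  have hcosh : ‖1 / (2 * (Real.cosh ξ : ℂ) ^ 2)‖ ≤ 1 / 2 := by
    rw [norm_div, norm_mul, norm_pow, Complex.norm_real, Real.norm_of_nonneg (Real.cosh_pos ξ).le,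
      norm_one, Complex.norm_ofNat]
    exact one_div_le_one_div_of_le two_pos (by nlinarith [Real.one_le_cosh ξ])
  have hlinear : ‖Complex.I * (Z : ℂ) / (2 * k) * (Real.tanh ξ : ℂ)‖ ≤ |Z| / (2 * δ) := by
    simp only [norm_mul, norm_div, Complex.norm_I, Complex.norm_real, Complex.norm_ofNat, one_mul,
      Real.norm_eq_abs]
    exact (mul_le_of_le_one_right (by positivity) htanh).trans (by gcongr)
  have hquadratic : ‖(Z : ℂ) ^ 2 / (4 * k ^ 2)‖ ≤ Z ^ 2 / (4 * δ ^ 2) := by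
    rw [norm_div, norm_mul, norm_pow, norm_pow, Complex.norm_real, Complex.norm_ofNat,
      Real.norm_eq_abs, sq_abs]
    gcongr
  exact (norm_sub_le_of_le (norm_sub_le_of_le (norm_sub_le_of_le
    (norm_sub_le_of_le htanh_sq hcosh) hlinear) hquadratic) le_rfl)

theorem inv_cosh_le (t : ℝ) : (Real.cosh t)⁻¹ ≤ 2 * Real.exp (-t) := by
  rw [inv_le_comm₀ (Real.cosh_pos t) (by positivity), mul_inv, ← Real.exp_neg, neg_neg,
    Real.cosh_eq]
  linarith [Real.exp_pos (-t)]

theorem norm_residual_div_cosh_le (Z : ℝ) (μ : ℂ) (t : ℝ) (hδ : 0 < δ) (hk : δ ≤ ‖k‖) :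
    ‖residual Z μ t k / (Real.cosh t : ℂ)‖ ≤ 2 * residualBound Z μ δ * Real.exp (-t) := by
  rw [norm_div, Complex.norm_real, Real.norm_of_nonneg (Real.cosh_pos t).le, div_eq_mul_inv]
  calc _ ≤ residualBound Z μ δ * (2 * Real.exp (-t)) :=
        mul_le_mul (norm_residual_le Z μ t hδ hk) (inv_cosh_le t)
          (inv_nonneg.2 (Real.cosh_pos t).le) (residualBound_nonneg Z μ hδ)
    _ = _ := by ring

/-- The functional `(z, w) ↦ z - e^{-ξ/2} w / (2ik)`, which recovers `m` from the pair
`(m + b / (2ik), e^{ξ/2} b)`. -/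
def factorFunctional (ξ : ℝ) (k : ℂ) : (ℂ × ℂ) →L[ℂ] ℂ :=
  ContinuousLinearMap.fst ℂ ℂ ℂ -
    ((Real.exp (-ξ / 2) : ℂ) / (2 * Complex.I * k)) • ContinuousLinearMap.snd ℂ ℂ ℂ

theorem norm_factorFunctional_le (hξ : 0 ≤ ξ) (hδ : 0 < δ) (hk : δ ≤ ‖k‖) :
    ‖factorFunctional ξ k‖ ≤ 1 + 1 / (2 * δ) := by
  refine norm_sub_le_of_le (ContinuousLinearMap.norm_fst_le ℂ ℂ ℂ) ?_
  have hexp : Real.exp (-ξ / 2) ≤ 1 := Real.exp_le_one_iff.2 (by linarith)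
  rw [norm_smul, norm_div, norm_mul, norm_mul, Complex.norm_real, Complex.norm_I,
    Complex.norm_ofNat, mul_one, Real.norm_of_nonneg (Real.exp_pos _).le]
  exact (mul_le_of_le_one_right (by positivity) (ContinuousLinearMap.norm_snd_le ℂ ℂ ℂ)).trans
    (by gcongr)

/-- The kernel of the Volterra equation for the pair `(m + b / (2ik), e^{ξ/2} b)`, where `y m` is
the solution of the radial equation and `m' = b cosh`. -/
def jostKernel (Z : ℝ) (μ : ℂ) (ξ s : ℝ) (k : ℂ) : (ℂ × ℂ) →L[ℂ] (ℂ × ℂ) :=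
  (ContinuousLinearMap.inl ℂ ℂ ℂ).comp
      ((residual Z μ (ξ + s) k / (Real.cosh (ξ + s) : ℂ) / (2 * Complex.I * k)) •
          factorFunctional (ξ + s) k +
        ((Z : ℂ) / (2 * k ^ 2) * (Real.exp (-(ξ + s) / 2) : ℂ)) •
          ContinuousLinearMap.snd ℂ ℂ ℂ) +
    (ContinuousLinearMap.inr ℂ ℂ ℂ).comp
      (((Real.exp (ξ / 2) : ℂ) * Complex.exp (2 * Complex.I * (phase Z (ξ + s) k - phase Z ξ k)) *
          (residual Z μ (ξ + s) k / (Real.cosh (ξ + s) : ℂ))) •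
        factorFunctional (ξ + s) k)

/-- The closed upper half-plane without a disc around `0`. -/
def upperDomain (δ : ℝ) : Set ℂ := {k | 0 ≤ k.im ∧ δ ≤ ‖k‖}

theorem ne_zero_of_mem_upperDomain (hδ : 0 < δ) (hk : k ∈ upperDomain δ) : k ≠ 0 :=
  norm_pos_iff.1 (hδ.trans_le hk.2)

theorem continuousAt_jostKernel (Z : ℝ) (μ : ℂ) {p : (ℝ × ℂ) × ℝ} (hk : p.1.2 ≠ 0) :
    ContinuousAt (fun p : (ℝ × ℂ) × ℝ => jostKernel Z μ p.1.1 p.2 p.1.2) p := by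
  have hcosh := ofReal_cosh_ne_zero (p.1.1 + p.2)
  have htanh : ContinuousAt (fun p : (ℝ × ℂ) × ℝ => (Real.tanh (p.1.1 + p.2) : ℂ)) p := by
    simp only [Real.tanh_eq_sinh_div_cosh, Complex.ofReal_div]
    fun_prop (disch := assumption)
  have hcosh_sq : 2 * (Real.cosh (p.1.1 + p.2) : ℂ) ^ 2 ≠ 0 := by simpa using hcosh
  have htwo : 2 * p.1.2 ≠ 0 := by simpa using hk
  have htwo_I : 2 * Complex.I * p.1.2 ≠ 0 := by simpa using hk
  have htwo_sq : 2 * p.1.2 ^ 2 ≠ 0 := by simpa using hk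
  have hfour : (4 : ℂ) ≠ 0 := by norm_num
  have hfour_sq : 4 * p.1.2 ^ 2 ≠ 0 := by simpa using hk
  unfold jostKernel factorFunctional residual phase
  fun_prop (disch := assumption)

theorem differentiableAt_jostKernel (Z : ℝ) (μ : ℂ) (ξ s : ℝ) (hk : k ≠ 0) :
    DifferentiableAt ℂ (jostKernel Z μ ξ s) k := by
  have htwo : 2 * k ≠ 0 := by simpa using hk
  have htwo_I : 2 * Complex.I * k ≠ 0 := by simpa using hk
  have htwo_sq : 2 * k ^ 2 ≠ 0 := by simpa using hk
  have hfour_sq : 4 * k ^ 2 ≠ 0 := by simpa using hk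
  unfold jostKernel factorFunctional residual phase
  fun_prop (disch := assumption)

theorem norm_residual_div_cosh_div_le (Z : ℝ) (μ : ℂ) (ht : 0 ≤ t) (hδ : 0 < δ) (hk : δ ≤ ‖k‖) :
    ‖residual Z μ t k / (Real.cosh t : ℂ) / (2 * Complex.I * k)‖ ≤
      residualBound Z μ δ / δ * Real.exp (-t / 2) := by
  have hB := residualBound_nonneg Z μ hδ
  rw [norm_div, norm_mul, norm_mul, Complex.norm_I, Complex.norm_ofNat, mul_one]
  calc _ ≤ 2 * residualBound Z μ δ * Real.exp (-t / 2) / (2 * δ) := by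
        gcongr
        exact (norm_residual_div_cosh_le Z μ t hδ hk).trans (by gcongr; linarith)
    _ = _ := by field_simp

theorem norm_inl_comp_add_inr_comp_le {E F G : Type*} [NormedAddCommGroup E] [NormedSpace ℂ E]
    [NormedAddCommGroup F] [NormedSpace ℂ F] [NormedAddCommGroup G] [NormedSpace ℂ G]
    (f : E →L[ℂ] F) (g : E →L[ℂ] G) :
    ‖(ContinuousLinearMap.inl ℂ F G).comp f + (ContinuousLinearMap.inr ℂ F G).comp g‖ ≤
      ‖f‖ + ‖g‖ :=
  norm_add_le_of_le
    ((ContinuousLinearMap.opNorm_comp_le _ _).trans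
      (mul_le_of_le_one_left (norm_nonneg _) (ContinuousLinearMap.norm_inl_le_one ℂ F G)))
    ((ContinuousLinearMap.opNorm_comp_le _ _).trans
      (mul_le_of_le_one_left (norm_nonneg _) (ContinuousLinearMap.norm_inr_le_one ℂ F G)))

theorem norm_exp_phase_mul_residual_le (Z : ℝ) (μ : ℂ) (h : ξ ≤ t) (hδ : 0 < δ)
    (hk : k ∈ upperDomain δ) :
    ‖(Real.exp (ξ / 2) : ℂ) * Complex.exp (2 * Complex.I * (phase Z t k - phase Z ξ k)) *
        (residual Z μ t k / (Real.cosh t : ℂ))‖ ≤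
      Real.exp (Z ^ 2 / δ ^ 3) * (2 * residualBound Z μ δ) * Real.exp (-t / 2) := by
  have hB := residualBound_nonneg Z μ hδ
  have hexp : Real.exp (ξ / 2) * Real.exp (-t) ≤ Real.exp (-t / 2) := by
    rw [← Real.exp_add, Real.exp_le_exp]
    linarith
  rw [norm_mul, norm_mul, Complex.norm_real, Real.norm_of_nonneg (Real.exp_pos _).le]
  calc _ ≤ Real.exp (ξ / 2) * Real.exp (Z ^ 2 / δ ^ 3) *
          (2 * residualBound Z μ δ * Real.exp (-t)) := by
        gcongr
        · exact norm_exp_phase_sub_le hδ hk.1 hk.2 h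
        · exact norm_residual_div_cosh_le Z μ t hδ hk.2
    _ = Real.exp (Z ^ 2 / δ ^ 3) * (2 * residualBound Z μ δ) *
          (Real.exp (ξ / 2) * Real.exp (-t)) := by ring
    _ ≤ _ := by gcongr

theorem exists_isVolterraKernel_jostKernel (Z : ℝ) (μ : ℂ) (hδ : 0 < δ) :
    ∃ C, IsVolterraKernel (jostKernel Z μ) (upperDomain δ) 0 C := by
  have hB := residualBound_nonneg Z μ hδ
  refine ⟨residualBound Z μ δ / δ * (1 + 1 / (2 * δ)) + |Z| / (2 * δ ^ 2) +
    Real.exp (Z ^ 2 / δ ^ 3) * (2 * residualBound Z μ δ) * (1 + 1 / (2 * δ)), by positivity,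
    fun p hp => (continuousAt_jostKernel Z μ
      (ne_zero_of_mem_upperDomain hδ hp)).continuousWithinAt, fun ξ hξ s hs k hk => ?_⟩
  have ht : 0 ≤ ξ + s := (add_pos hξ hs).le
  have hL := norm_factorFunctional_le ht hδ hk.2
  have hsnd : ‖((Z : ℂ) / (2 * k ^ 2) * (Real.exp (-(ξ + s) / 2) : ℂ)) •
      ContinuousLinearMap.snd ℂ ℂ ℂ‖ ≤ |Z| / (2 * δ ^ 2) * Real.exp (-(ξ + s) / 2) := by
    rw [norm_smul, norm_mul, norm_div, norm_mul, norm_pow, Complex.norm_real, Complex.norm_real,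
      Complex.norm_ofNat, Real.norm_eq_abs, Real.norm_of_nonneg (Real.exp_pos _).le]
    refine (mul_le_of_le_one_right (by positivity) (ContinuousLinearMap.norm_snd_le ℂ ℂ ℂ)).trans ?_
    gcongr
    exact hk.2
  calc ‖jostKernel Z μ ξ s k‖
      ≤ residualBound Z μ δ / δ * Real.exp (-(ξ + s) / 2) * (1 + 1 / (2 * δ)) +
          |Z| / (2 * δ ^ 2) * Real.exp (-(ξ + s) / 2) +
        Real.exp (Z ^ 2 / δ ^ 3) * (2 * residualBound Z μ δ) * Real.exp (-(ξ + s) / 2) *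
          (1 + 1 / (2 * δ)) := by
        refine (norm_inl_comp_add_inr_comp_le _ _).trans
          (add_le_add (norm_add_le_of_le ?_ hsnd) ?_)
        · rw [norm_smul]
          gcongr
          exact norm_residual_div_cosh_div_le Z μ ht hδ hk.2
        · rw [norm_smul]
          gcongr
          exact norm_exp_phase_mul_residual_le Z μ (by linarith) hδ hk
    _ = _ := by ring

end Kernel

section JostSolution

/-- The Volterra solution whose components are `m + b / (2ik)` and `e^{ξ/2} b`. -/
def jostPair (Z : ℝ) (μ : ℂ) (ξ : ℝ) (k : ℂ) : ℂ × ℂ := volterraSum (jostKernel Z μ) (1, 0) ξ k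

/-- The factor `m` by which the Jost solution differs from the comparison function. -/
def jostFactor (Z : ℝ) (μ : ℂ) (ξ : ℝ) (k : ℂ) : ℂ := factorFunctional ξ k (jostPair Z μ ξ k)

/-- The Jost solution: for `Im k ≥ 0` the solution of the radial equation that is asymptotic to the
comparison function. -/
def jostSolution (Z : ℝ) (μ : ℂ) (ξ : ℝ) (k : ℂ) : ℂ := comparison Z ξ k * jostFactor Z μ ξ k

variable {Z ξ δ : ℝ} {μ k : ℂ}

theorem continuousOn_jostFactor (Z : ℝ) (μ : ℂ) (hδ : 0 < δ) (hξ : 0 < ξ) :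
    ContinuousOn (jostFactor Z μ ξ) (upperDomain δ) := by
  obtain ⟨C, hM⟩ := exists_isVolterraKernel_jostKernel Z μ hδ
  have hfunctional : ContinuousOn (factorFunctional ξ) (upperDomain δ) := fun k hk => by
    have hne : 2 * Complex.I * k ≠ 0 := by simpa using ne_zero_of_mem_upperDomain hδ hk
    unfold factorFunctional
    exact ContinuousAt.continuousWithinAt (by fun_prop (disch := assumption))
  exact hfunctional.clm_apply <| (hM.continuousOn_sum (1, 0)).comp (f := fun k => (ξ, k))
    (by fun_prop) fun k hk => ⟨hξ, hk⟩

theorem differentiableOn_jostFactor (Z : ℝ) (μ : ℂ) (hδ : 0 < δ) (hξ : 0 < ξ) :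
    DifferentiableOn ℂ (jostFactor Z μ ξ) {k | 0 < k.im ∧ δ < ‖k‖} := by
  obtain ⟨C, hM⟩ := exists_isVolterraKernel_jostKernel Z μ hδ
  have hopen : IsOpen {k : ℂ | 0 < k.im ∧ δ < ‖k‖} :=
    (isOpen_lt continuous_const Complex.continuous_im).inter
      (isOpen_lt continuous_const continuous_norm)
  have hne : ∀ k ∈ {k : ℂ | 0 < k.im ∧ δ < ‖k‖}, k ≠ 0 := fun k hk =>
    norm_pos_iff.1 (hδ.trans hk.2)
  have hfunctional : DifferentiableOn ℂ (factorFunctional ξ) {k | 0 < k.im ∧ δ < ‖k‖} :=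
    fun k hk => by
      have hne : 2 * Complex.I * k ≠ 0 := by simpa using hne k hk
      unfold factorFunctional
      exact DifferentiableAt.differentiableWithinAt (by fun_prop (disch := assumption))
  exact hfunctional.clm_apply <| hM.differentiableOn_sum (1, 0) hopen
    (fun k hk => ⟨hk.1.le, hk.2.le⟩) (fun ξ s k hk =>
      (differentiableAt_jostKernel Z μ ξ s (hne k hk)).differentiableWithinAt) hξ

theorem tendstoUniformlyOn_jostFactor (Z : ℝ) (μ : ℂ) (hδ : 0 < δ) :
    TendstoUniformlyOn (jostFactor Z μ) (fun _ => 1) atTop (upperDomain δ) := by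
  obtain ⟨C, hM⟩ := exists_isVolterraKernel_jostKernel Z μ hδ
  have hpair := hM.tendstoUniformlyOn_sum (1, 0)
  rw [Metric.tendstoUniformlyOn_iff] at hpair ⊢
  intro ε hε
  have hL : 0 < 1 + 1 / (2 * δ) := by positivity
  filter_upwards [hpair (ε / (1 + 1 / (2 * δ))) (by positivity), eventually_gt_atTop 0]
    with ξ hdist hξ k hk
  have hone : factorFunctional ξ k (1, 0) = 1 := by simp [factorFunctional]
  rw [jostFactor, ← hone, dist_eq_norm, ← map_sub]
  refine ((factorFunctional ξ k).le_of_opNorm_le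
    (norm_factorFunctional_le hξ.le hδ hk.2) _).trans_lt ?_
  rw [← dist_eq_norm, mul_comm]
  exact (lt_div_iff₀ hL).1 (hdist k hk)

theorem continuous_jostKernel_zero (Z : ℝ) (μ : ℂ) (hk : k ≠ 0) :
    Continuous fun t => jostKernel Z μ t 0 k :=
  continuous_iff_continuousAt.2 fun t => (continuousAt_jostKernel Z μ (p := ((t, k), 0)) hk).comp
    (f := fun t : ℝ => ((t, k), (0 : ℝ))) (by fun_prop)

theorem hasDerivAt_jostPair_fst (hδ : 0 < δ) (hk : k ∈ upperDomain δ) (hξ : 0 < ξ) :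
    HasDerivAt (fun ξ => (jostPair Z μ ξ k).1)
      (-(residual Z μ ξ k / (Real.cosh ξ : ℂ) / (2 * Complex.I * k) * jostFactor Z μ ξ k +
        (Z : ℂ) / (2 * k ^ 2) * ((Real.exp (-ξ / 2) : ℂ) * (jostPair Z μ ξ k).2))) ξ := by
  obtain ⟨C, hM⟩ := exists_isVolterraKernel_jostKernel Z μ hδ
  have hkernel := continuous_jostKernel_zero Z μ (ne_zero_of_mem_upperDomain hδ hk)
  refine (hM.hasDerivAt_clm_sum (1, 0) (ContinuousLinearMap.fst ℂ ℂ ℂ) (g := fun _ => 1)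
    (N := fun t => (ContinuousLinearMap.fst ℂ ℂ ℂ).comp (jostKernel Z μ t 0 k))
    (fun _ => one_ne_zero) (by fun_prop) hk (fun y s z _ _ => by simp [jostKernel]) hξ
    (hasDerivAt_const ξ 1)).congr_deriv ?_
  simp [jostKernel, jostFactor, jostPair, mul_assoc]

theorem jostKernel_apply_snd (Z : ℝ) (μ : ℂ) (ξ s : ℝ) (k : ℂ) (z : ℂ × ℂ) :
    (jostKernel Z μ ξ s k z).2 = (Real.exp (ξ / 2) : ℂ) *
      Complex.exp (2 * Complex.I * (phase Z (ξ + s) k - phase Z ξ k)) *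
        (residual Z μ (ξ + s) k / (Real.cosh (ξ + s) : ℂ)) * factorFunctional (ξ + s) k z := by
  simp [jostKernel]

theorem hasDerivAt_jostPair_snd (hδ : 0 < δ) (hk : k ∈ upperDomain δ) (hξ : 0 < ξ) :
    HasDerivAt (fun ξ => (jostPair Z μ ξ k).2)
      ((1 / 2 - 2 * Complex.I * phaseDeriv Z ξ k) * (jostPair Z μ ξ k).2 -
        (Real.exp (ξ / 2) : ℂ) * (residual Z μ ξ k / (Real.cosh ξ : ℂ) * jostFactor Z μ ξ k))
      ξ := by
  obtain ⟨C, hM⟩ := exists_isVolterraKernel_jostKernel Z μ hδ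
  set g : ℝ → ℂ := fun y => (Real.exp (y / 2) : ℂ) * Complex.exp (-(2 * Complex.I * phase Z y k))
  have hg₀ : ∀ y, g y ≠ 0 := fun y =>
    mul_ne_zero (Complex.ofReal_ne_zero.2 (Real.exp_pos _).ne') (Complex.exp_ne_zero _)
  have hg : ∀ y, HasDerivAt g (g y * (1 / 2 - 2 * Complex.I * phaseDeriv Z y k)) y := fun y => by
    refine ((((hasDerivAt_id y).div_const 2).exp.ofReal_comp).mul
      ((hasDerivAt_phase Z y k).const_mul (2 * Complex.I)).neg.cexp).congr_deriv ?_
    simp only [g, id, Pi.neg_apply]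
    push_cast
    ring
  have hgc : Continuous g := continuous_iff_continuousAt.2 fun y => (hg y).continuousAt
  have hratio : ∀ y t, (Real.exp (y / 2) : ℂ) *
      Complex.exp (2 * Complex.I * (phase Z t k - phase Z y k)) =
        g y * ((g t)⁻¹ * (Real.exp (t / 2) : ℂ)) := fun y t => by
    have hexp : (Real.exp (t / 2) : ℂ) ≠ 0 := Complex.ofReal_ne_zero.2 (Real.exp_pos _).ne'
    rw [mul_sub, Complex.exp_sub]
    simp only [g, Complex.exp_neg]
    field_simp
  have hN : Continuous fun t => (g t)⁻¹ •
      (ContinuousLinearMap.snd ℂ ℂ ℂ).comp (jostKernel Z μ t 0 k) :=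
    (hgc.inv₀ hg₀).smul
      (continuous_const.clm_comp
        (continuous_jostKernel_zero Z μ (ne_zero_of_mem_upperDomain hδ hk)))
  refine (hM.hasDerivAt_clm_sum (1, 0) (ContinuousLinearMap.snd ℂ ℂ ℂ) hg₀ hN.continuousOn hk
    (fun y s z _ _ => ?_) hξ (hg ξ)).congr_deriv ?_
  · have hcomp : (jostKernel Z μ y s k z).2 = g y * ((g (y + s))⁻¹ *
        (jostKernel Z μ (y + s) 0 k z).2) := by
      rw [jostKernel_apply_snd, jostKernel_apply_snd, hratio, add_zero, sub_self, mul_zero,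
        Complex.exp_zero]
      ring
    exact hcomp
  · rw [mul_div_cancel_left₀ _ (hg₀ ξ)]
    simp [jostKernel, jostFactor, jostPair, mul_assoc]

theorem hasDerivAt_exp_neg_half_mul_jostPair_snd (hδ : 0 < δ) (hk : k ∈ upperDomain δ)
    (hξ : 0 < ξ) :
    HasDerivAt (fun ξ => (Real.exp (-ξ / 2) : ℂ) * (jostPair Z μ ξ k).2)
      (-2 * Complex.I * phaseDeriv Z ξ k * ((Real.exp (-ξ / 2) : ℂ) * (jostPair Z μ ξ k).2) -
        residual Z μ ξ k / (Real.cosh ξ : ℂ) * jostFactor Z μ ξ k) ξ := by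
  have hexp : HasDerivAt (fun ξ : ℝ => (Real.exp (-ξ / 2) : ℂ))
      ((Real.exp (-ξ / 2) * (-1 / 2) : ℝ) : ℂ) ξ :=
    ((hasDerivAt_neg ξ).div_const 2).exp.ofReal_comp
  have hcancel : (Real.exp (-ξ / 2) : ℂ) * (Real.exp (ξ / 2) : ℂ) = 1 := by
    rw [← Complex.ofReal_mul, ← Real.exp_add, neg_div, neg_add_cancel, Real.exp_zero,
      Complex.ofReal_one]
  refine (hexp.mul (hasDerivAt_jostPair_snd hδ hk hξ)).congr_deriv ?_
  push_cast at hcancel ⊢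
  linear_combination -(residual Z μ ξ k / Complex.cosh ξ * jostFactor Z μ ξ k) * hcancel

theorem hasDerivAt_jostFactor (hδ : 0 < δ) (hk : k ∈ upperDomain δ) (hξ : 0 < ξ) :
    HasDerivAt (fun ξ => jostFactor Z μ ξ k)
      ((Real.cosh ξ : ℂ) * ((Real.exp (-ξ / 2) : ℂ) * (jostPair Z μ ξ k).2)) ξ := by
  have hk₀ := ne_zero_of_mem_upperDomain hδ hk
  have hfactor : (fun ξ => jostFactor Z μ ξ k) = fun ξ => (jostPair Z μ ξ k).1 -
      (Real.exp (-ξ / 2) : ℂ) * (jostPair Z μ ξ k).2 / (2 * Complex.I * k) := by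
    ext ξ
    simp only [jostFactor, factorFunctional, sub_apply, smul_apply, smul_eq_mul,
      ContinuousLinearMap.coe_fst', ContinuousLinearMap.coe_snd']
    ring
  rw [hfactor]
  refine ((hasDerivAt_jostPair_fst hδ hk hξ).sub
    ((hasDerivAt_exp_neg_half_mul_jostPair_snd hδ hk hξ).div_const _)).congr_deriv ?_
  have hI := Complex.I_ne_zero
  have hcosh := ofReal_cosh_ne_zero ξ
  rw [phaseDeriv]
  field_simp
  ring

theorem exists_isSolutionPair_jostSolution (Z : ℝ) (μ : ℂ) (hk : 0 ≤ k.im) (hk₀ : k ≠ 0) :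
    ∃ v', IsSolutionPair (radialCoeff Z μ k) (fun ξ => jostSolution Z μ ξ k) v' := by
  have hδ : 0 < ‖k‖ := norm_pos_iff.2 hk₀
  have hkδ : k ∈ upperDomain ‖k‖ := ⟨hk, le_rfl⟩
  exact ⟨_, isSolutionPair_comparison_mul hk₀
    (fun _ hξ => hasDerivAt_jostFactor hδ hkδ hξ)
    (fun _ hξ => hasDerivAt_exp_neg_half_mul_jostPair_snd hδ hkδ hξ)⟩

end JostSolution

section GrowingSolution

variable {Z ξ : ℝ} {μ k : ℂ}

theorem isLittleO_atTop_of_deriv {E : Type*} [NormedAddCommGroup E] [NormedSpace ℝ E]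
    {f f' : ℝ → E} {h h' : ℝ → ℝ} (hf : ∀ᶠ x in atTop, HasDerivAt f (f' x) x)
    (hh : ∀ᶠ x in atTop, HasDerivAt h (h' x) x) (hh' : ∀ᶠ x in atTop, 0 ≤ h' x)
    (hfh : f' =o[atTop] h') (htop : Tendsto h atTop atTop) : f =o[atTop] h := by
  refine Asymptotics.IsLittleO.of_bound fun ε hε => ?_
  obtain ⟨T, hT⟩ := eventually_atTop.1
    (hf.and (hh.and (hh'.and (hfh.bound (half_pos hε)))))
  have hlim : Tendsto (fun x => (‖f T‖ - ε / 2 * h T) / h x) atTop (𝓝 0) := htop.const_div_atTop _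
  filter_upwards [eventually_ge_atTop T, htop.eventually_gt_atTop 0,
    hlim.eventually_lt_const (half_pos hε)] with x hx hpos hlt
  have hB : ∀ y, T ≤ y → HasDerivAt (fun y => ‖f T‖ + ε / 2 * (h y - h T)) (ε / 2 * h' y) y :=
    fun y hy => (((hT y hy).2.1.sub_const _).const_mul _).const_add _
  have hbound : ‖f x‖ ≤ ‖f T‖ + ε / 2 * (h x - h T) :=
    image_norm_le_of_norm_deriv_right_le_deriv_boundary' (B := fun y => ‖f T‖ + ε / 2 * (h y - h T))
      (fun y hy => (hT y hy.1).1.continuousAt.continuousWithinAt)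
      (fun y hy => (hT y hy.1).1.hasDerivWithinAt) (by simp)
      (fun y hy => (hB y hy.1).continuousAt.continuousWithinAt)
      (fun y hy => (hB y hy.1).hasDerivWithinAt)
      (fun y hy => by
        simpa only [Real.norm_of_nonneg (hT y hy.1).2.2.1] using (hT y hy.1).2.2.2)
      (right_mem_Icc.2 hx)
  rw [div_lt_iff₀ hpos] at hlt
  rw [Real.norm_of_nonneg hpos.le]
  linarith

theorem tendsto_sinh_sub_mul_atTop (β : ℝ) :
    Tendsto (fun ξ => Real.sinh ξ - β * ξ) atTop atTop := by
  have hquadratic : Tendsto (fun ξ : ℝ => ξ * (ξ / 4 + -β)) atTop atTop :=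
    tendsto_id.atTop_mul_atTop₀
      (tendsto_atTop_add_const_right _ _ (tendsto_id.atTop_div_const (by norm_num)))
  refine tendsto_atTop_mono' _ ?_ hquadratic
  filter_upwards [eventually_ge_atTop 0] with ξ hξ
  linarith [sq_div_four_le_sinh hξ]

theorem tendsto_cosh_atTop : Tendsto Real.cosh atTop atTop :=
  tendsto_atTop_mono (fun ξ => (Real.sinh_lt_cosh ξ).le)
    (by simpa using tendsto_sinh_sub_mul_atTop 0)

theorem tendsto_ofReal_cosh_inv : Tendsto (fun ξ : ℝ => (Real.cosh ξ : ℂ)⁻¹) atTop (𝓝 0) := by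
  simpa [Function.comp_def] using
    (Complex.continuous_ofReal.tendsto 0).comp tendsto_cosh_atTop.inv_tendsto_atTop

theorem norm_exp_two_I_mul_phase (Z ξ : ℝ) (k : ℂ) :
    ‖Complex.exp (2 * Complex.I * phase Z ξ k)‖ =
      Real.exp (-2 * k.im * (Real.sinh ξ - Z / (2 * ‖k‖ ^ 2) * ξ)) := by
  rw [norm_exp_two_I_mul, im_phase, mul_assoc]

theorem comparison_neg_mul_exp (Z ξ : ℝ) (k : ℂ) :
    comparison Z ξ (-k) * Complex.exp (2 * Complex.I * phase Z ξ k) = comparison Z ξ k := by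
  rw [comparison, comparison, mul_assoc, ← Complex.exp_add, phase_neg]
  ring_nf

theorem comparison_sq_mul_cosh (Z ξ : ℝ) (k : ℂ) :
    comparison Z ξ k ^ 2 * (Real.cosh ξ : ℂ) = Complex.exp (2 * Complex.I * phase Z ξ k) := by
  have hsqrt : (((Real.sqrt (Real.cosh ξ))⁻¹ : ℝ) : ℂ) ^ 2 * (Real.cosh ξ : ℂ) = 1 := by
    rw [← Complex.ofReal_pow, ← Complex.ofReal_mul, inv_pow, Real.sq_sqrt (Real.cosh_pos ξ).le,
      inv_mul_cancel₀ (Real.cosh_pos ξ).ne', Complex.ofReal_one]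
  rw [comparison, mul_pow, ← Complex.exp_nat_mul, mul_right_comm, hsqrt, one_mul, Nat.cast_two,
    mul_assoc]

theorem tendsto_jostFactor (hk : 0 ≤ k.im) (hk₀ : k ≠ 0) :
    Tendsto (fun ξ => jostFactor Z μ ξ k) atTop (𝓝 1) :=
  (tendstoUniformlyOn_jostFactor Z μ (norm_pos_iff.2 hk₀)).tendsto_at ⟨hk, le_rfl⟩

theorem isLittleO_exp_two_I_mul_phase (hk : k.im < 0) {f ε : ℝ → ℂ}
    (hf : ∀ᶠ ξ in atTop, HasDerivAt f
      (Complex.exp (2 * Complex.I * phase Z ξ k) * (Real.cosh ξ : ℂ) * ε ξ) ξ)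
    (hε : Tendsto ε atTop (𝓝 0)) :
    f =o[atTop] fun ξ => Complex.exp (2 * Complex.I * phase Z ξ k) := by
  set β := Z / (2 * ‖k‖ ^ 2)
  set h : ℝ → ℝ := fun ξ => Real.exp (-2 * k.im * (Real.sinh ξ - β * ξ))
  have hnorm : ∀ ξ, ‖Complex.exp (2 * Complex.I * phase Z ξ k)‖ = h ξ := fun ξ =>
    norm_exp_two_I_mul_phase Z ξ k
  have hderiv : ∀ ξ, HasDerivAt h (h ξ * (-2 * k.im * (Real.cosh ξ - β))) ξ := fun ξ => by
    refine ((((Real.hasDerivAt_sinh ξ).sub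
      ((hasDerivAt_id ξ).const_mul β)).const_mul (-2 * k.im)).exp).congr_deriv ?_
    simp [h]
  have htop : Tendsto h atTop atTop :=
    Real.tendsto_exp_atTop.comp
      ((tendsto_sinh_sub_mul_atTop β).const_mul_atTop (by linarith))
  have hcosh : ∀ᶠ ξ in atTop, 2 * β ≤ Real.cosh ξ := tendsto_cosh_atTop.eventually_ge_atTop _
  refine .of_norm_right <| (isLittleO_atTop_of_deriv hf (.of_forall hderiv) ?_ ?_ htop).congr_right
    fun ξ => (hnorm ξ).symm
  · filter_upwards [hcosh] with ξ hξ
    have hc := Real.cosh_pos ξ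
    exact mul_nonneg (Real.exp_pos _).le (mul_nonneg (by linarith) (by linarith))
  · have hO : (fun ξ => Complex.exp (2 * Complex.I * phase Z ξ k) * (Real.cosh ξ : ℂ))
        =O[atTop] fun ξ => h ξ * (-2 * k.im * (Real.cosh ξ - β)) := by
      refine .of_bound (-k.im)⁻¹ ?_
      filter_upwards [hcosh] with ξ hξ
      have hc := Real.cosh_pos ξ
      have hk' : 0 < -k.im := neg_pos.2 hk
      rw [norm_mul, norm_mul, norm_mul, hnorm, Complex.norm_real, Real.norm_of_nonneg hc.le,
        Real.norm_of_nonneg (Real.exp_pos _).le, Real.norm_of_nonneg (by linarith),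
        Real.norm_of_nonneg (by linarith), le_inv_mul_iff₀ hk']
      have hh : 0 ≤ h ξ := (Real.exp_pos _).le
      linarith [mul_nonneg (mul_nonneg hh hk'.le) (sub_nonneg.2 hξ)]
    simpa using hO.mul_isLittleO ((Asymptotics.isLittleO_one_iff ℝ).2 hε)

theorem jostSolution_neg_mul_exp (Z : ℝ) (μ : ℂ) (ξ : ℝ) (k : ℂ) :
    jostSolution Z μ ξ (-k) * Complex.exp (2 * Complex.I * phase Z ξ k) =
      comparison Z ξ k * jostFactor Z μ ξ (-k) := by
  rw [jostSolution, mul_right_comm, comparison_neg_mul_exp]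

theorem inv_jostSolution_neg_sq (Z : ℝ) (μ : ℂ) (ξ : ℝ) (k : ℂ) :
    (jostSolution Z μ ξ (-k) ^ 2)⁻¹ = Complex.exp (2 * Complex.I * phase Z ξ k) *
      (Real.cosh ξ : ℂ) * (jostFactor Z μ ξ (-k) ^ 2)⁻¹ := by
  have hexp := Complex.exp_ne_zero (2 * Complex.I * phase Z ξ k)
  have hcosh := ofReal_cosh_ne_zero ξ
  have hsq : jostSolution Z μ ξ (-k) ^ 2 * (Complex.exp (2 * Complex.I * phase Z ξ k) *
      (Real.cosh ξ : ℂ)) = jostFactor Z μ ξ (-k) ^ 2 := by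
    refine mul_right_cancel₀ hexp ?_
    linear_combination
      (jostSolution Z μ ξ (-k) * Complex.exp (2 * Complex.I * phase Z ξ k) +
        comparison Z ξ k * jostFactor Z μ ξ (-k)) * (Real.cosh ξ : ℂ) *
          jostSolution_neg_mul_exp Z μ ξ k +
        jostFactor Z μ ξ (-k) ^ 2 * comparison_sq_mul_cosh Z ξ k
  rw [← hsq]
  field_simp

/-- The derivative is `E cosh ξ` times a quantity tending to zero, where `E = exp(2iψ)`: this
determines the growing solution `w` asymptotically. -/
theorem hasDerivAt_div_jostSolution_neg_sub {v' w w' : ℝ → ℂ} (hk₀ : k ≠ 0)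
    (hv : IsSolutionPair (radialCoeff Z μ k) (fun ξ => jostSolution Z μ ξ (-k)) v')
    (hw : IsSolutionPair (radialCoeff Z μ k) w w') (hξ : 0 < ξ)
    (hwronskian : wronskian (fun ξ => jostSolution Z μ ξ (-k)) v' w w' ξ = 1)
    (hne : jostSolution Z μ ξ (-k) ≠ 0) :
    HasDerivAt (fun ξ => w ξ / jostSolution Z μ ξ (-k) -
        Complex.exp (2 * Complex.I * phase Z ξ k) / (2 * Complex.I * k))
      (Complex.exp (2 * Complex.I * phase Z ξ k) * (Real.cosh ξ : ℂ) *
        ((jostFactor Z μ ξ (-k) ^ 2)⁻¹ - 1 - (Z : ℂ) / (2 * k ^ 2) * (Real.cosh ξ : ℂ)⁻¹)) ξ := by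
  have hcosh := ofReal_cosh_ne_zero ξ
  have hexp := (((hasDerivAt_phase Z ξ k).const_mul (2 * Complex.I)).cexp).div_const
    (2 * Complex.I * k)
  refine ((hv.hasDerivAt_div hw hξ hne).sub hexp).congr_deriv ?_
  have hI := Complex.I_ne_zero
  rw [hwronskian, one_div, inv_jostSolution_neg_sq, phaseDeriv]
  field_simp
  ring

theorem exists_growing_solution (Z : ℝ) (μ : ℂ) (hk : k.im < 0) :
    ∃ w w' : ℝ → ℂ, IsSolutionPair (radialCoeff Z μ k) w w' ∧
      Tendsto (fun ξ => w ξ / comparison Z ξ k) atTop (𝓝 1) := by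
  have hk₀ : k ≠ 0 := by rintro rfl; simp at hk
  have hneg : 0 ≤ (-k).im := by simpa using hk.le
  set v : ℝ → ℂ := fun ξ => jostSolution Z μ ξ (-k)
  set m : ℝ → ℂ := fun ξ => jostFactor Z μ ξ (-k)
  set E : ℝ → ℂ := fun ξ => Complex.exp (2 * Complex.I * phase Z ξ k)
  have hm : Tendsto m atTop (𝓝 1) := tendsto_jostFactor hneg (neg_ne_zero.2 hk₀)
  obtain ⟨v', hv⟩ := exists_isSolutionPair_jostSolution Z μ hneg (neg_ne_zero.2 hk₀)
  rw [radialCoeff_neg] at hv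
  have hvne : ∀ᶠ ξ in atTop, v ξ ≠ 0 := (hm.eventually_ne one_ne_zero).mono fun ξ h =>
    mul_ne_zero (comparison_ne_zero _ _ _) h
  obtain ⟨ξ₀, hξ₀, hvξ₀⟩ := ((eventually_gt_atTop (0 : ℝ)).and hvne).exists
  obtain ⟨w, w', hw, hW⟩ := hv.exists_wronskian_eq_one (continuous_radialCoeff Z μ k) hξ₀ hvξ₀
  have hdefect : Tendsto (fun ξ => (m ξ ^ 2)⁻¹ - 1 - (Z : ℂ) / (2 * k ^ 2) * (Real.cosh ξ : ℂ)⁻¹)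
      atTop (𝓝 0) := by
    simpa using (((hm.pow 2).inv₀ (by simp)).sub_const 1).sub
      (tendsto_ofReal_cosh_inv.const_mul ((Z : ℂ) / (2 * k ^ 2)))
  have hsmall : Tendsto (fun ξ => (w ξ / v ξ - E ξ / (2 * Complex.I * k)) / E ξ) atTop (𝓝 0) := by
    refine (isLittleO_exp_two_I_mul_phase hk ?_ hdefect).tendsto_div_nhds_zero
    filter_upwards [eventually_gt_atTop 0, hvne] with ξ hξ hvξ
    exact hasDerivAt_div_jostSolution_neg_sub hk₀ hv hw hξ (hW ξ hξ) hvξ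
  refine ⟨_, _, hw.const_mul (2 * Complex.I * k), ?_⟩
  have hlim := ((hsmall.const_mul (2 * Complex.I * k)).add_const 1).mul hm
  rw [mul_zero, zero_add, one_mul] at hlim
  refine hlim.congr' ?_
  filter_upwards [hvne] with ξ hvξ
  have hE : E ξ ≠ 0 := Complex.exp_ne_zero _
  have hy := comparison_ne_zero Z ξ k
  have hvE : v ξ * E ξ = comparison Z ξ k * m ξ := jostSolution_neg_mul_exp Z μ ξ k
  have hI := Complex.I_ne_zero
  field_simp
  linear_combination 2 * Complex.I * k * w ξ * hvE.symm

end GrowingSolution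

section Nonconvergence

theorem atTop_le_map_atTop {θ : ℝ → ℝ} (hθ : Continuous θ) (htop : Tendsto θ atTop atTop) :
    atTop ≤ map θ atTop := fun s hs => by
  obtain ⟨N, hN⟩ := mem_atTop_sets.1 hs
  filter_upwards [eventually_ge_atTop (θ N)] with y hy
  obtain ⟨T, hyT, hNT⟩ := ((htop.eventually_ge_atTop y).and (eventually_ge_atTop N)).exists
  obtain ⟨x, hx, rfl⟩ := intermediate_value_Icc hNT hθ.continuousOn ⟨hy, hyT⟩
  exact hN x hx.1

theorem not_tendsto_cos_atTop (a : ℝ) : ¬ Tendsto Real.cos atTop (𝓝 a) := fun h => by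
  have htop : Tendsto (fun n : ℕ => (n : ℝ) * (2 * Real.pi)) atTop atTop :=
    tendsto_natCast_atTop_atTop.atTop_mul_const (by positivity)
  have hone := h.comp htop
  have hneg := h.comp (tendsto_atTop_add_const_right _ Real.pi htop)
  simp only [Function.comp_def, Real.cos_nat_mul_two_pi, Real.cos_nat_mul_two_pi_add_pi,
    tendsto_const_nhds_iff] at hone hneg
  linarith

variable {k : ℂ}

theorem not_tendsto_exp_phase_of_im_eq_zero (Z : ℝ) (hk : k.im = 0) (hk₀ : k ≠ 0) (a : ℂ) :
    ¬ Tendsto (fun ξ => Complex.exp (-(2 * Complex.I * phase Z ξ k))) atTop (𝓝 a) := by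
  lift k to ℝ using hk with r
  have hr : (r : ℂ) ≠ 0 := hk₀
  set θ : ℝ → ℝ := fun ξ => |2 * r| * (Real.sinh ξ - -Z / (2 * r ^ 2) * ξ) with hθ
  have htop : Tendsto θ atTop atTop :=
    (tendsto_sinh_sub_mul_atTop _).const_mul_atTop (by simpa using hk₀)
  have hcont : Continuous θ := by fun_prop
  have hre : ∀ ξ, (Complex.exp (-(2 * Complex.I * phase Z ξ r))).re = Real.cos (θ ξ) := fun ξ => by
    have harg : -(2 * Complex.I * phase Z ξ r) =
        ((-(2 * r * (Real.sinh ξ - -Z / (2 * r ^ 2) * ξ)) : ℝ) : ℂ) * Complex.I := by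
      rw [phase]
      push_cast
      field_simp
      ring
    rw [harg, Complex.exp_ofReal_mul_I_re, Real.cos_neg, hθ]
    rcases abs_choice (2 * r) with habs | habs
    · simp only [habs]
    · simp only [habs, neg_mul, Real.cos_neg]
  intro h
  have hcos : Tendsto (Real.cos ∘ θ) atTop (𝓝 a.re) :=
    ((Complex.continuous_re.tendsto a).comp h).congr hre
  exact not_tendsto_cos_atTop a.re
    ((tendsto_map'_iff.2 hcos).mono_left (atTop_le_map_atTop hcont htop))

theorem not_tendsto_exp_phase (Z : ℝ) (hk : 0 ≤ k.im) (hk₀ : k ≠ 0) (a : ℂ) :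
    ¬ Tendsto (fun ξ => Complex.exp (-(2 * Complex.I * phase Z ξ k))) atTop (𝓝 a) := by
  rcases hk.eq_or_lt' with hreal | hpos
  · exact not_tendsto_exp_phase_of_im_eq_zero Z hreal hk₀ a
  · intro h
    refine not_tendsto_nhds_of_tendsto_atTop ?_ ‖a‖ h.norm
    have hnorm : ∀ ξ, ‖Complex.exp (-(2 * Complex.I * phase Z ξ k))‖ =
        Real.exp (2 * k.im * (Real.sinh ξ - Z / (2 * ‖k‖ ^ 2) * ξ)) := fun ξ => by
      rw [Complex.exp_neg, norm_inv, norm_exp_two_I_mul_phase, ← Real.exp_neg]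
      ring_nf
    simp only [hnorm]
    exact Real.tendsto_exp_atTop.comp
      ((tendsto_sinh_sub_mul_atTop _).const_mul_atTop (by linarith))

end Nonconvergence

section JostFamily

/-- A family of solutions of the radial equation that are asymptotic to the comparison function,
uniformly and holomorphically for `k` in the upper half-plane. -/
structure IsJostFamily (Z : ℝ) (μ : ℂ) (V : ℝ → ℂ → ℂ) : Prop where
  exists_isSolutionPair : ∀ k : ℂ, k ≠ 0 →
    ∃ v', IsSolutionPair (radialCoeff Z μ k) (fun ξ => V ξ k) v'
  tendsto_div : ∀ k : ℂ, k ≠ 0 → Tendsto (fun ξ => V ξ k / comparison Z ξ k) atTop (𝓝 1)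
  tendstoUniformlyOn_div : ∀ δ : ℝ, 0 < δ →
    TendstoUniformlyOn (fun ξ k => V ξ k / comparison Z ξ k) (fun _ => 1) atTop (upperDomain δ)
  differentiableOn : ∀ ξ : ℝ, 0 < ξ → DifferentiableOn ℂ (V ξ) {k | 0 < k.im}
  continuousOn : ∀ ξ : ℝ, 0 < ξ → ContinuousOn (V ξ) {k | 0 ≤ k.im ∧ k ≠ 0}

variable {Z ξ : ℝ} {μ k : ℂ}

theorem jostSolution_div_comparison (Z : ℝ) (μ : ℂ) (ξ : ℝ) (k : ℂ) :
    jostSolution Z μ ξ k / comparison Z ξ k = jostFactor Z μ ξ k :=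
  mul_div_cancel_left₀ _ (comparison_ne_zero Z ξ k)

theorem differentiableAt_comparison (Z ξ : ℝ) (hk₀ : k ≠ 0) :
    DifferentiableAt ℂ (comparison Z ξ) k := by
  have htwo : 2 * k ≠ 0 := mul_ne_zero two_ne_zero hk₀
  unfold comparison phase
  fun_prop (disch := assumption)

theorem differentiableOn_jostSolution (Z : ℝ) (μ : ℂ) (hξ : 0 < ξ) :
    DifferentiableOn ℂ (jostSolution Z μ ξ) {k | 0 < k.im} := fun k hk => by
  have hk₀ : k ≠ 0 := by rintro rfl; simp at hk
  have hnorm : 0 < ‖k‖ := norm_pos_iff.2 hk₀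
  have hnhds : {k' : ℂ | 0 < k'.im ∧ ‖k‖ / 2 < ‖k'‖} ∈ 𝓝 k :=
    ((isOpen_lt continuous_const Complex.continuous_im).inter
      (isOpen_lt continuous_const continuous_norm)).mem_nhds ⟨hk, half_lt_self hnorm⟩
  exact ((differentiableAt_comparison Z ξ hk₀).mul
    ((differentiableOn_jostFactor Z μ (half_pos hnorm) hξ).differentiableAt
      hnhds)).differentiableWithinAt

theorem continuousOn_jostSolution (Z : ℝ) (μ : ℂ) (hξ : 0 < ξ) :
    ContinuousOn (jostSolution Z μ ξ) {k | 0 ≤ k.im ∧ k ≠ 0} := fun k ⟨him, hk₀⟩ => by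
  have hnorm : 0 < ‖k‖ := norm_pos_iff.2 hk₀
  have hnhds : {k' : ℂ | ‖k‖ / 2 < ‖k'‖} ∈ 𝓝 k :=
    (isOpen_lt continuous_const continuous_norm).mem_nhds (half_lt_self hnorm)
  have hfactor := continuousOn_jostFactor Z μ (half_pos hnorm) hξ k ⟨him, (half_lt_self hnorm).le⟩
  refine (differentiableAt_comparison Z ξ hk₀).continuousAt.continuousWithinAt.mul
    (hfactor.mono_of_mem_nhdsWithin ?_)
  filter_upwards [self_mem_nhdsWithin, nhdsWithin_le_nhds hnhds] with k' hk' hlt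
  exact ⟨hk'.1, le_of_lt hlt⟩

theorem exists_isJostFamily (Z : ℝ) (μ : ℂ) : ∃ V, IsJostFamily Z μ V := by
  choose! w w' hw hlim using fun k : ℂ => exists_growing_solution Z μ (k := k)
  set V : ℝ → ℂ → ℂ := fun ξ k => if 0 ≤ k.im then jostSolution Z μ ξ k else w k ξ
  have hupper : ∀ ξ k, 0 ≤ k.im → V ξ k = jostSolution Z μ ξ k := fun ξ k hk => if_pos hk
  have hlower : ∀ ξ k, k.im < 0 → V ξ k = w k ξ := fun ξ k hk => if_neg hk.not_ge
  have hdiv : ∀ ξ k, 0 ≤ k.im → V ξ k / comparison Z ξ k = jostFactor Z μ ξ k := fun ξ k hk => by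
    rw [hupper ξ k hk, jostSolution_div_comparison]
  refine ⟨V, fun k hk₀ => ?_, fun k hk₀ => ?_, fun δ hδ => ?_, fun ξ hξ => ?_, fun ξ hξ => ?_⟩
  · rcases le_or_gt 0 k.im with hk | hk
    · simpa only [hupper _ k hk] using exists_isSolutionPair_jostSolution Z μ hk hk₀
    · simpa only [hlower _ k hk] using ⟨w' k, hw k hk⟩
  · rcases le_or_gt 0 k.im with hk | hk
    · simpa only [hdiv _ k hk] using tendsto_jostFactor hk hk₀
    · simpa only [hlower _ k hk] using hlim k hk
  · exact (tendstoUniformlyOn_jostFactor Z μ hδ).congr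
      (.of_forall fun ξ k hk => (hdiv ξ k hk.1).symm)
  · exact (differentiableOn_jostSolution Z μ hξ).congr fun k hk => hupper ξ k (le_of_lt hk)
  · exact (continuousOn_jostSolution Z μ hξ).congr fun k hk => hupper ξ k hk.1

namespace IsJostFamily

variable {V : ℝ → ℂ → ℂ}

theorem eq_zero_of_tendsto_combination (hV : IsJostFamily Z μ V) (hk : 0 ≤ k.im) (hk₀ : k ≠ 0)
    {α β : ℂ}
    (h : Tendsto (fun ξ => (α * V ξ k + β * V ξ (-k)) / comparison Z ξ k) atTop (𝓝 0)) :
    α = 0 ∧ β = 0 := by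
  have hF := hV.tendsto_div k hk₀
  have hG := hV.tendsto_div (-k) (neg_ne_zero.2 hk₀)
  have hβG : Tendsto (fun ξ => β * V ξ (-k) / comparison Z ξ k) atTop (𝓝 (0 - α * 1)) := by
    refine (h.sub (hF.const_mul α)).congr fun ξ => ?_
    ring
  have hβ : β = 0 := by
    by_contra hβ
    refine not_tendsto_exp_phase Z hk hk₀ _
      (((hβG.const_mul β⁻¹).mul (hG.inv₀ one_ne_zero)).congr' ?_)
    filter_upwards [hG.eventually_ne one_ne_zero] with ξ hξ
    have hc := comparison_ne_zero Z ξ (-k)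
    have hV₀ : V ξ (-k) ≠ 0 := fun h₀ => hξ (by rw [h₀, zero_div])
    have hexp := Complex.exp_ne_zero (2 * Complex.I * phase Z ξ k)
    rw [← comparison_neg_mul_exp Z ξ k, Complex.exp_neg]
    field_simp
  have hα : 0 = 0 - α * 1 := tendsto_nhds_unique (by simp [hβ]) hβG
  exact ⟨by simpa using hα, hβ⟩

theorem exists_wronskian_eq_ne_zero (hV : IsJostFamily Z μ V) (hk : 0 ≤ k.im) (hk₀ : k ≠ 0)
    {v' w' : ℝ → ℂ} (hv : IsSolutionPair (radialCoeff Z μ k) (fun ξ => V ξ k) v')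
    (hw : IsSolutionPair (radialCoeff Z μ k) (fun ξ => V ξ (-k)) w') :
    ∃ γ ≠ 0, ∀ ξ, 0 < ξ → wronskian (fun ξ => V ξ k) v' (fun ξ => V ξ (-k)) w' ξ = γ := by
  obtain ⟨γ, hγ⟩ := hv.exists_wronskian_eq hw
  refine ⟨γ, ?_, hγ⟩
  rintro rfl
  obtain ⟨ξ₀, hξ₀, hne⟩ := ((eventually_gt_atTop (0 : ℝ)).and
    ((hV.tendsto_div k hk₀).eventually_ne one_ne_zero)).exists
  obtain ⟨u, u', hu, hW⟩ := hv.exists_wronskian_eq_one (continuous_radialCoeff Z μ k) hξ₀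
    (fun h₀ => hne (by simp [h₀]))
  obtain ⟨α, hα⟩ := hw.exists_wronskian_eq hu
  have hdependent : ∀ ξ, 0 < ξ → -α * V ξ k + 1 * V ξ (-k) = 0 := fun ξ hξ => by
    have hvw := hγ ξ hξ
    have hvu := hW ξ hξ
    have hwu := hα ξ hξ
    simp only [wronskian] at hvw hvu hwu
    linear_combination -V ξ (-k) * hvu + V ξ k * hwu + u ξ * hvw
  refine one_ne_zero (hV.eq_zero_of_tendsto_combination hk hk₀ (α := -α) (β := 1)
    (tendsto_const_nhds.congr' ?_)).2
  filter_upwards [eventually_gt_atTop 0] with ξ hξ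
  rw [hdependent ξ hξ, zero_div]

/-- The hypothesis on `v` and `w` makes the coefficients of `v - w` in the basis
`V(·, k), V(·, -k)` vanish. -/
theorem eq_of_tendsto_div (hV : IsJostFamily Z μ V) (hk : 0 ≤ k.im) (hk₀ : k ≠ 0)
    {v v' w w' : ℝ → ℂ} {c : ℂ} (hv : IsSolutionPair (radialCoeff Z μ k) v v')
    (hw : IsSolutionPair (radialCoeff Z μ k) w w')
    (hvc : Tendsto (fun ξ => v ξ / comparison Z ξ k) atTop (𝓝 c))
    (hwc : Tendsto (fun ξ => w ξ / comparison Z ξ k) atTop (𝓝 c)) (hξ : 0 < ξ) : v ξ = w ξ := by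
  obtain ⟨F', hF⟩ := hV.exists_isSolutionPair k hk₀
  obtain ⟨G', hG⟩ := hV.exists_isSolutionPair (-k) (neg_ne_zero.2 hk₀)
  rw [radialCoeff_neg] at hG
  obtain ⟨γ, hγ₀, hγ⟩ := hV.exists_wronskian_eq_ne_zero hk hk₀ hF hG
  obtain ⟨α, hα⟩ := (hv.sub hw).exists_wronskian_eq hG
  obtain ⟨β, hβ⟩ := hF.exists_wronskian_eq (hv.sub hw)
  have hbasis : ∀ ξ, 0 < ξ → γ * (v ξ - w ξ) = α * V ξ k + β * V ξ (-k) := fun ξ hξ => by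
    rw [← hγ ξ hξ, ← hα ξ hξ, ← hβ ξ hξ]
    simp only [wronskian]
    ring
  have hlim : Tendsto (fun ξ => (α * V ξ k + β * V ξ (-k)) / comparison Z ξ k) atTop (𝓝 0) := by
    have hdiff := (hvc.sub hwc).const_mul γ
    rw [sub_self, mul_zero] at hdiff
    refine hdiff.congr' ?_
    filter_upwards [eventually_gt_atTop 0] with ξ hξ
    rw [← hbasis ξ hξ, ← sub_div, mul_div_assoc]
  obtain ⟨rfl, rfl⟩ := hV.eq_zero_of_tendsto_combination hk hk₀ hlim
  simpa [hγ₀, sub_eq_zero] using hbasis ξ hξ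

end IsJostFamily

end JostFamily

section PhaseLimit

theorem re_cpow_half_nonneg (z : ℂ) : 0 ≤ (z ^ (1 / 2 : ℂ)).re := by
  rw [one_div, Complex.cpow_inv_two_re]
  positivity

theorem norm_cpow_half_one_sub_le (z : ℂ) :
    ‖(1 - z) ^ (1 / 2 : ℂ) - 1 + z / 2‖ ≤ ‖z‖ ^ 2 / 2 := by
  have hsq : ((1 - z) ^ (1 / 2 : ℂ)) ^ 2 = 1 - z := by
    simpa only [one_div] using Complex.cpow_ofNat_inv_pow (1 - z) 2
  set w := (1 - z) ^ (1 / 2 : ℂ)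
  have hone : 1 ≤ ‖w + 1‖ := by
    have hre : 0 ≤ w.re := re_cpow_half_nonneg _
    have hle := Complex.re_le_norm (w + 1)
    rw [Complex.add_re, Complex.one_re] at hle
    linarith
  have hsub : ‖w - 1‖ ≤ ‖z‖ := by
    calc ‖w - 1‖ ≤ ‖w - 1‖ * ‖w + 1‖ := le_mul_of_one_le_right (norm_nonneg _) hone
      _ = ‖z‖ := by
        rw [← norm_mul, ← norm_neg z, show (w - 1) * (w + 1) = -z by linear_combination hsq]
  rw [show w - 1 + z / 2 = -((w - 1) ^ 2 / 2) by linear_combination (1 / 2 : ℂ) * hsq, norm_neg,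
    norm_div, norm_pow, Complex.norm_ofNat]
  gcongr

/-- The integrand of the difference between the local phase and the comparison phase, in the
variable `τ = sinh ξ`. -/
def phaseDefect (Z : ℝ) (l : ℝ → ℝ) (k : ℂ) (τ : ℝ) : ℂ :=
  k * (1 - (l τ : ℂ) / k ^ 2) ^ (1 / 2 : ℂ) -
    (k + (Z : ℂ) / (2 * k) * (((Real.sqrt (1 + τ ^ 2))⁻¹ : ℝ) : ℂ))

variable {Z δ τ : ℝ} {μ k : ℂ} {j : ℕ} {l : ℝ → ℝ}

theorem norm_phaseDefect_le (Z : ℝ) (l : ℝ → ℝ) (τ : ℝ) (hδ : 0 < δ) (hk : δ ≤ ‖k‖) :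
    ‖phaseDefect Z l k τ‖ ≤
      l τ ^ 2 / (2 * δ ^ 3) + |l τ + Z * (Real.sqrt (1 + τ ^ 2))⁻¹| / (2 * δ) := by
  have hk₀ : k ≠ 0 := norm_pos_iff.1 (hδ.trans_le hk)
  have hsplit : phaseDefect Z l k τ =
      k * ((1 - (l τ : ℂ) / k ^ 2) ^ (1 / 2 : ℂ) - 1 + (l τ : ℂ) / k ^ 2 / 2) -
        ((l τ + Z * (Real.sqrt (1 + τ ^ 2))⁻¹ : ℝ) : ℂ) / (2 * k) := by
    rw [phaseDefect]
    generalize (1 - (l τ : ℂ) / k ^ 2) ^ (1 / 2 : ℂ) = w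
    push_cast
    field_simp
    ring
  rw [hsplit]
  refine (norm_sub_le _ _).trans (add_le_add ?_ ?_)
  · calc _ ≤ ‖k‖ * (‖(l τ : ℂ) / k ^ 2‖ ^ 2 / 2) := by
          rw [norm_mul]
          gcongr
          exact norm_cpow_half_one_sub_le _
      _ = l τ ^ 2 / (2 * ‖k‖ ^ 3) := by
          rw [norm_div, Complex.norm_real, norm_pow, div_pow, Real.norm_eq_abs, sq_abs]
          field_simp
      _ ≤ _ := by gcongr
  · rw [norm_div, Complex.norm_real, norm_mul, Complex.norm_ofNat, Real.norm_eq_abs]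
    gcongr

theorem norm_phaseDefect_le_of_eq (hl : l τ = -(Z / Real.sqrt (1 + τ ^ 2))) (hδ : 0 < δ)
    (hk : δ ≤ ‖k‖) : ‖phaseDefect Z l k τ‖ ≤ Z ^ 2 / (2 * δ ^ 3) * (1 + τ ^ 2)⁻¹ := by
  refine (norm_phaseDefect_le Z l τ hδ hk).trans_eq ?_
  rw [hl, div_eq_mul_inv Z, neg_add_cancel, abs_zero, zero_div, add_zero, neg_sq, mul_pow, inv_pow,
    Real.sq_sqrt (by positivity)]
  ring

theorem norm_phaseDefect_le_of_abs_le (hl : |l τ| ≤ δ ^ 2) (hδ : 0 < δ) (hk : δ ≤ ‖k‖) :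
    ‖phaseDefect Z l k τ‖ ≤ (δ ^ 2) ^ 2 / (2 * δ ^ 3) + (δ ^ 2 + |Z|) / (2 * δ) := by
  have hsqrt : (Real.sqrt (1 + τ ^ 2))⁻¹ ≤ 1 :=
    inv_le_one_of_one_le₀ (Real.one_le_sqrt.2 (by linarith [sq_nonneg τ]))
  refine (norm_phaseDefect_le Z l τ hδ hk).trans (add_le_add ?_ ?_)
  · rw [← sq_abs]
    gcongr
  · gcongr
    refine (abs_add_le _ _).trans (add_le_add hl ?_)
    rw [abs_mul, abs_of_nonneg (by positivity : 0 ≤ (Real.sqrt (1 + τ ^ 2))⁻¹)]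
    exact mul_le_of_le_one_right (abs_nonneg _) hsqrt

theorem exists_norm_phaseDefect_le (hl : IsLongRangePart Z μ j l) (hjδ : 1 / (j : ℝ) < δ ^ 2)
    (hδ : 0 < δ) :
    ∃ C : ℝ, ∀ τ, 0 < τ → ∀ k : ℂ, δ ≤ ‖k‖ → ‖phaseDefect Z l k τ‖ ≤ C * (1 + τ ^ 2)⁻¹ := by
  obtain ⟨R, hR⟩ := hl.eq_of_large
  set B := (δ ^ 2) ^ 2 / (2 * δ ^ 3) + (δ ^ 2 + |Z|) / (2 * δ)
  have : 0 ≤ B := by positivity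
  refine ⟨max (Z ^ 2 / (2 * δ ^ 3)) (B * (1 + R ^ 2)), fun τ hτ k hk => ?_⟩
  have hτ₁ : 0 < 1 + τ ^ 2 := by positivity
  rcases lt_or_ge R τ with hlarge | hsmall
  · refine (norm_phaseDefect_le_of_eq (hR τ hlarge) hδ hk).trans ?_
    gcongr
    exact le_max_left _ _
  · calc ‖phaseDefect Z l k τ‖ ≤ B :=
          norm_phaseDefect_le_of_abs_le ((hl.abs_le τ hτ).trans hjδ.le) hδ hk
      _ ≤ B * (1 + R ^ 2) * (1 + τ ^ 2)⁻¹ := by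
          rw [← div_eq_mul_inv, le_div_iff₀ hτ₁]
          gcongr
      _ ≤ _ := by
          gcongr
          exact le_max_right _ _

theorem one_sub_div_sq_mem_slitPlane (hl : IsLongRangePart Z μ j l) (hjδ : 1 / (j : ℝ) < δ ^ 2)
    (hδ : 0 < δ) (hk : δ ≤ ‖k‖) (hτ : 0 < τ) :
    1 - (l τ : ℂ) / k ^ 2 ∈ Complex.slitPlane := by
  have hk₀ : 0 < ‖k‖ := hδ.trans_le hk
  rw [sub_eq_add_neg]
  apply Complex.mem_slitPlane_of_norm_lt_one
  rw [norm_neg, norm_div, norm_pow, Complex.norm_real, Real.norm_eq_abs, div_lt_one (by positivity)]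
  exact ((hl.abs_le τ hτ).trans_lt hjδ).trans_le (by gcongr)

theorem continuous_inv_sqrt_one_add_sq :
    Continuous fun τ : ℝ => (((Real.sqrt (1 + τ ^ 2))⁻¹ : ℝ) : ℂ) :=
  Complex.continuous_ofReal.comp (Continuous.inv₀ (by fun_prop) fun τ => by positivity)

theorem continuousOn_phaseDefect (hl : IsLongRangePart Z μ j l) (hjδ : 1 / (j : ℝ) < δ ^ 2)
    (hδ : 0 < δ) (hk : δ ≤ ‖k‖) : ContinuousOn (phaseDefect Z l k) (Ioi 0) := by
  have hradicand : ContinuousOn (fun τ => 1 - (l τ : ℂ) / k ^ 2) (Ioi 0) :=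
    continuousOn_const.sub
      ((Complex.continuous_ofReal.comp_continuousOn hl.contDiffOn.continuousOn).div_const _)
  have hroot : ContinuousOn (fun τ => (1 - (l τ : ℂ) / k ^ 2) ^ (1 / 2 : ℂ)) (Ioi 0) :=
    hradicand.cpow continuousOn_const fun τ hτ => one_sub_div_sq_mem_slitPlane hl hjδ hδ hk hτ
  exact (continuousOn_const.mul hroot).sub
    (continuousOn_const.add (continuousOn_const.mul continuous_inv_sqrt_one_add_sq.continuousOn))

theorem integrableOn_phaseDefect (hl : IsLongRangePart Z μ j l) (hjδ : 1 / (j : ℝ) < δ ^ 2)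
    (hδ : 0 < δ) (hk : δ ≤ ‖k‖) : IntegrableOn (phaseDefect Z l k) (Ioi 0) := by
  obtain ⟨C, hC⟩ := exists_norm_phaseDefect_le hl hjδ hδ
  refine (integrable_inv_one_add_sq.integrableOn.const_mul C).mono'
    ((continuousOn_phaseDefect hl hjδ hδ hk).aestronglyMeasurable measurableSet_Ioi) ?_
  filter_upwards [ae_restrict_mem measurableSet_Ioi] with τ hτ using hC τ hτ k hk

theorem integral_inv_sqrt_one_add_sq (ξ : ℝ) :
    ∫ τ in (0 : ℝ)..Real.sinh ξ, (((Real.sqrt (1 + τ ^ 2))⁻¹ : ℝ) : ℂ) = ξ := by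
  rw [intervalIntegral.integral_ofReal,
    intervalIntegral.integral_eq_sub_of_hasDerivAt fun x _ => Real.hasDerivAt_arsinh x]
  · simp
  · exact (Continuous.inv₀ (by fun_prop) fun τ => by positivity).intervalIntegrable _ _

theorem phase_eq_integral (Z ξ : ℝ) (k : ℂ) :
    phase Z ξ k = ∫ τ in (0 : ℝ)..Real.sinh ξ,
      (k + (Z : ℂ) / (2 * k) * (((Real.sqrt (1 + τ ^ 2))⁻¹ : ℝ) : ℂ)) := by
  rw [intervalIntegral.integral_add intervalIntegrable_const
    ((continuous_inv_sqrt_one_add_sq.const_mul _).intervalIntegrable _ _),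
    intervalIntegral.integral_const, intervalIntegral.integral_const_mul,
    integral_inv_sqrt_one_add_sq, phase, Complex.real_smul]
  push_cast
  ring

theorem localPhase_sub_phase (hl : IsLongRangePart Z μ j l) (hjδ : 1 / (j : ℝ) < δ ^ 2)
    (hδ : 0 < δ) (hk : δ ≤ ‖k‖) {ξ : ℝ} (hξ : 0 < ξ) :
    localPhase l ξ k - phase Z ξ k = ∫ τ in (0 : ℝ)..Real.sinh ξ, phaseDefect Z l k τ := by
  have hdefect : IntervalIntegrable (phaseDefect Z l k) volume 0 (Real.sinh ξ) := by
    rw [intervalIntegrable_iff_integrableOn_Ioc_of_le (Real.sinh_pos_iff.2 hξ).le]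
    exact (integrableOn_phaseDefect hl hjδ hδ hk).mono_set Ioc_subset_Ioi_self
  have hphase := (continuous_inv_sqrt_one_add_sq.const_mul ((Z : ℂ) / (2 * k))).const_add k
  rw [phase_eq_integral, sub_eq_iff_eq_add,
    ← intervalIntegral.integral_add hdefect (hphase.intervalIntegrable _ _)]
  simp [localPhase, phaseDefect]

theorem tendstoUniformlyOn_localPhase_sub_phase (hl : IsLongRangePart Z μ j l)
    (hjδ : 1 / (j : ℝ) < δ ^ 2) (hδ : 0 < δ) :
    TendstoUniformlyOn (fun ξ k => localPhase l ξ k - phase Z ξ k)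
      (fun k => ∫ τ in Ioi (0 : ℝ), phaseDefect Z l k τ) atTop {k | δ ≤ ‖k‖} := by
  obtain ⟨C, hC⟩ := exists_norm_phaseDefect_le hl hjδ hδ
  have hlim : Tendsto (fun ξ => C * (Real.pi / 2 - Real.arctan (Real.sinh ξ))) atTop (𝓝 0) := by
    have hsinh : Tendsto Real.sinh atTop atTop := by simpa using tendsto_sinh_sub_mul_atTop 0
    simpa using (((tendsto_nhds_of_tendsto_nhdsWithin
      Real.tendsto_arctan_atTop).comp hsinh).const_sub (Real.pi / 2)).const_mul C
  rw [Metric.tendstoUniformlyOn_iff]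
  intro ε hε
  filter_upwards [eventually_gt_atTop 0, hlim.eventually_lt_const hε] with ξ hξ hlt k hk
  have hsinh : 0 < Real.sinh ξ := Real.sinh_pos_iff.2 hξ
  rw [localPhase_sub_phase hl hjδ hδ hk hξ, dist_eq_norm,
    ← intervalIntegral.integral_Ioi_sub_Ioi (integrableOn_phaseDefect hl hjδ hδ hk) hsinh.le,
    sub_sub_cancel]
  refine (norm_integral_le_of_norm_le
    (integrable_inv_one_add_sq.integrableOn.const_mul C) ?_).trans_lt ?_
  · filter_upwards [ae_restrict_mem measurableSet_Ioi] with τ hτ using hC τ (hsinh.trans hτ) k hk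
  · rwa [integral_const_mul, integral_Ioi_inv_one_add_sq]

theorem differentiableOn_integral_phaseDefect (hl : IsLongRangePart Z μ j l)
    (hjδ : 1 / (j : ℝ) < δ ^ 2) (hδ : 0 < δ) :
    DifferentiableOn ℂ (fun k => ∫ τ in Ioi (0 : ℝ), phaseDefect Z l k τ) {k | δ < ‖k‖} := by
  obtain ⟨C, hC⟩ := exists_norm_phaseDefect_le hl hjδ hδ
  refine differentiableOn_integral_of_dominated (isOpen_lt continuous_const continuous_norm)
    (bound := fun τ => C * (1 + τ ^ 2)⁻¹) (fun k hk =>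
      (continuousOn_phaseDefect hl hjδ hδ (le_of_lt hk)).aestronglyMeasurable measurableSet_Ioi)
    ?_ ?_ (integrable_inv_one_add_sq.integrableOn.const_mul C)
  · filter_upwards [ae_restrict_mem measurableSet_Ioi] with τ hτ k hk
    have hδk : δ < ‖k‖ := hk
    have hk₀ : k ≠ 0 := norm_pos_iff.1 (hδ.trans hδk)
    have htwo : 2 * k ≠ 0 := mul_ne_zero two_ne_zero hk₀
    have hsq : k ^ 2 ≠ 0 := pow_ne_zero _ hk₀
    have hroot : DifferentiableAt ℂ (fun k : ℂ => (1 - (l τ : ℂ) / k ^ 2) ^ (1 / 2 : ℂ)) k :=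
      DifferentiableAt.cpow (by fun_prop (disch := assumption)) (by fun_prop)
        (one_sub_div_sq_mem_slitPlane hl hjδ hδ hδk.le hτ)
    apply DifferentiableAt.differentiableWithinAt
    unfold phaseDefect
    fun_prop (disch := assumption)
  · filter_upwards [ae_restrict_mem measurableSet_Ioi] with τ hτ k hk using
      hC τ hτ k (le_of_lt hk)

/-- `Θ` is the limit of `φ - ψ` as `ξ → ∞`, where `ψ` is the comparison phase: the convergence is
uniform outside every disc around `0` and `Θ` is holomorphic outside `0`. -/
structure IsPhaseCorrection (Z : ℝ) (φ : ℝ → ℂ → ℂ) (Θ : ℂ → ℂ) : Prop where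
  differentiableOn : DifferentiableOn ℂ Θ {0}ᶜ
  tendstoUniformlyOn : ∀ δ : ℝ, 0 < δ →
    TendstoUniformlyOn (fun ξ k => φ ξ k - phase Z ξ k) Θ atTop {k | δ ≤ ‖k‖}

namespace IsGlobalPhase

variable {φ : ℝ → ℂ → ℂ}

theorem exists_tendstoUniformlyOn_sub_phase (hφ : IsGlobalPhase Z μ φ) (hδ : 0 < δ) :
    ∃ Θ : ℂ → ℂ, DifferentiableOn ℂ Θ {k | δ < ‖k‖} ∧
      TendstoUniformlyOn (fun ξ k => φ ξ k - phase Z ξ k) Θ atTop {k | δ ≤ ‖k‖} := by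
  obtain ⟨n, hn⟩ := exists_nat_one_div_lt (show 0 < δ ^ 2 by positivity)
  have hjδ : 1 / ((n + 1 : ℕ) : ℝ) < δ ^ 2 := by exact_mod_cast hn
  obtain ⟨l, hl, g, hg, R, hR⟩ := hφ.patch (n + 1) n.succ_pos
  have hΩ : ∀ k : ℂ, δ ≤ ‖k‖ → k ∈ Omega (n + 1) := fun k hk => hjδ.trans_le (by gcongr)
  refine ⟨fun k => (∫ τ in Ioi (0 : ℝ), phaseDefect Z l k τ) + g k,
    (differentiableOn_integral_phaseDefect hl hjδ hδ).add
      (hg.differentiableOn.mono fun k hk => hΩ k (le_of_lt hk)), ?_⟩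
  have hlocal := tendstoUniformlyOn_localPhase_sub_phase hl hjδ hδ
  rw [Metric.tendstoUniformlyOn_iff] at hlocal ⊢
  intro ε hε
  filter_upwards [hlocal ε hε, eventually_gt_atTop R] with ξ hdist hξ k hk
  rw [hR ξ hξ k (hΩ k hk), add_sub_right_comm, dist_add_right]
  exact hdist k hk

theorem exists_isPhaseCorrection (hφ : IsGlobalPhase Z μ φ) : ∃ Θ, IsPhaseCorrection Z φ Θ := by
  choose! Θ hΘ hlim using fun δ : ℝ => hφ.exists_tendstoUniformlyOn_sub_phase (δ := δ)
  have hglue : ∀ δ, 0 < δ → ∀ k : ℂ, δ ≤ ‖k‖ → Θ δ k = Θ ‖k‖ k := fun δ hδ k hk =>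
    tendsto_nhds_unique ((hlim δ hδ).tendsto_at hk)
      ((hlim ‖k‖ (hδ.trans_le hk)).tendsto_at (le_refl ‖k‖))
  refine ⟨fun k => Θ ‖k‖ k, fun k hk => ?_, fun δ hδ => (hlim δ hδ).congr_right (hglue δ hδ)⟩
  have hδ : 0 < ‖k‖ / 2 := half_pos (norm_pos_iff.2 hk)
  have hnhds : {k' : ℂ | ‖k‖ / 2 < ‖k'‖} ∈ 𝓝 k :=
    (isOpen_lt continuous_const continuous_norm).mem_nhds (half_lt_self (norm_pos_iff.2 hk))
  refine (((hΘ _ hδ).differentiableAt hnhds).congr_of_eventuallyEq ?_).differentiableWithinAt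
  filter_upwards [hnhds] with k' hk' using (hglue _ hδ k' (le_of_lt hk')).symm

end IsGlobalPhase

end PhaseLimit

section Asymptotics

variable {Z σ : ℝ} {μ k : ℂ} {φ V : ℝ → ℂ → ℂ} {Θ : ℂ → ℂ}

theorem leadingTerm_ne_zero (σ : ℝ) (φ : ℝ → ℂ → ℂ) (ξ : ℝ) (k : ℂ) :
    leadingTerm σ φ ξ k ≠ 0 := by
  have hamplitude : Real.sqrt 2 * Real.exp (-ξ / 2) ≠ 0 := by positivity
  exact mul_ne_zero (Complex.ofReal_ne_zero.2 hamplitude) (Complex.exp_ne_zero _)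

theorem phase_sign_mul (hσ : σ = 1 ∨ σ = -1) (Z ξ : ℝ) (k : ℂ) :
    phase Z ξ (σ * k) = σ * phase Z ξ k := by
  rcases hσ with rfl | rfl
  · simp
  · simpa using phase_neg Z ξ k

theorem radialCoeff_sign_mul (hσ : σ = 1 ∨ σ = -1) (Z : ℝ) (μ k : ℂ) :
    radialCoeff Z μ (σ * k) = radialCoeff Z μ k := by
  rcases hσ with rfl | rfl
  · simp
  · simpa using radialCoeff_neg Z μ k

theorem isRadialSolution_iff (hσ : σ = 1 ∨ σ = -1) {v : ℝ → ℂ} :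
    IsRadialSolution Z μ k v ↔ ∃ v', IsSolutionPair (radialCoeff Z μ (σ * k)) v v' := by
  rw [radialCoeff_sign_mul hσ]
  rfl

theorem norm_sign_mul (hσ : σ = 1 ∨ σ = -1) (k : ℂ) : ‖(σ : ℂ) * k‖ = ‖k‖ := by
  rcases hσ with rfl | rfl <;> simp

theorem sign_mul_ne_zero (hσ : σ = 1 ∨ σ = -1) (hk₀ : k ≠ 0) : (σ : ℂ) * k ≠ 0 := by
  rw [← norm_pos_iff, norm_sign_mul hσ]
  exact norm_pos_iff.2 hk₀

theorem sign_mul_mem_upperDomain (hσ : σ = 1 ∨ σ = -1) {η δ : ℝ} (hη : 0 ≤ η)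
    (hk : k ∈ truncatedCone σ η δ) : (σ : ℂ) * k ∈ upperDomain δ :=
  ⟨Complex.arg_nonneg_iff.1 (hη.trans hk.2.1), (norm_sign_mul hσ k).symm ▸ hk.2.2.2⟩

theorem isOpen_halfPlane (σ : ℝ) : IsOpen (halfPlane σ) :=
  isOpen_lt continuous_const (continuous_const.mul Complex.continuous_im)

theorem sign_mul_im_pos (hk : k ∈ halfPlane σ) : 0 < ((σ : ℂ) * k).im := by
  rwa [Complex.im_ofReal_mul]

theorem ne_zero_of_mem_halfPlane (hk : k ∈ halfPlane σ) : k ≠ 0 := by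
  rintro rfl
  simp [halfPlane] at hk

theorem sign_mul_im_nonneg (hk : k ∈ closure (halfPlane σ)) : 0 ≤ ((σ : ℂ) * k).im := by
  have hclosed : IsClosed {k : ℂ | 0 ≤ ((σ : ℂ) * k).im} :=
    isClosed_le continuous_const (by fun_prop)
  exact closure_minimal (fun k hk => (sign_mul_im_pos hk).le) hclosed hk

/-- The ratio of the amplitudes of the comparison function and of the leading term. -/
def amplitudeRatio (ξ : ℝ) : ℝ :=
  (Real.sqrt (Real.cosh ξ))⁻¹ / (Real.sqrt 2 * Real.exp (-ξ / 2))

theorem amplitudeRatio_eq (ξ : ℝ) :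
    amplitudeRatio ξ = (Real.sqrt (1 + Real.exp (-2 * ξ)))⁻¹ := by
  have hexp : Real.exp (-ξ / 2) = Real.sqrt (Real.exp (-ξ)) := Real.exp_half (-ξ)
  have hsplit : 1 + Real.exp (-2 * ξ) = Real.cosh ξ * (2 * Real.exp (-ξ)) := by
    rw [Real.cosh_eq, div_mul_eq_mul_div, mul_left_comm, mul_div_cancel_left₀ _ two_ne_zero,
      add_mul, ← Real.exp_add, ← Real.exp_add, add_neg_cancel, Real.exp_zero]
    ring_nf
  rw [amplitudeRatio, hexp, hsplit, Real.sqrt_mul (Real.cosh_pos ξ).le, Real.sqrt_mul zero_le_two,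
    mul_inv, div_eq_mul_inv]

theorem tendsto_amplitudeRatio : Tendsto amplitudeRatio atTop (𝓝 1) := by
  have hexp : Tendsto (fun ξ : ℝ => Real.exp (-2 * ξ)) atTop (𝓝 0) :=
    Real.tendsto_exp_atBot.comp (tendsto_id.const_mul_atTop_of_neg (by norm_num))
  simpa only [← amplitudeRatio_eq, add_zero, Real.sqrt_one, inv_one] using
    (hexp.const_add 1).sqrt.inv₀ (by simp)

/-- The solutions of a Jost family at `σk`, normalised so that the phase of their leading term is
`σφ` instead of `σψ`, where `Θ` is the limit of `φ - ψ`. -/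
def phaseCorrected (σ : ℝ) (Θ : ℂ → ℂ) (V : ℝ → ℂ → ℂ) (ξ : ℝ) (k : ℂ) : ℂ :=
  Complex.exp (σ * Complex.I * Θ k) * V ξ (σ * k)

theorem phaseCorrected_div_leadingTerm (hσ : σ = 1 ∨ σ = -1) (Z ξ : ℝ) (k : ℂ)
    (φ V : ℝ → ℂ → ℂ) (Θ : ℂ → ℂ) :
    phaseCorrected σ Θ V ξ k / leadingTerm σ φ ξ k =
      V ξ (σ * k) / comparison Z ξ (σ * k) * (amplitudeRatio ξ : ℂ) *
        Complex.exp (-(σ * Complex.I) * (φ ξ k - phase Z ξ k - Θ k)) := by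
  have hamplitude : (((Real.sqrt (Real.cosh ξ))⁻¹ : ℝ) : ℂ) ≠ 0 :=
    Complex.ofReal_ne_zero.2 (inv_ne_zero (Real.sqrt_pos.2 (Real.cosh_pos ξ)).ne')
  have hexp : Complex.exp (-(σ * Complex.I) * (φ ξ k - phase Z ξ k - Θ k)) =
      Complex.exp (σ * Complex.I * Θ k) * Complex.exp (Complex.I * (σ * phase Z ξ k)) /
        Complex.exp (σ * Complex.I * φ ξ k) := by
    rw [← Complex.exp_add, ← Complex.exp_sub]
    ring_nf
  rw [phaseCorrected, leadingTerm, comparison, amplitudeRatio, phase_sign_mul hσ, hexp,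
    Complex.ofReal_div]
  generalize (((Real.sqrt (Real.cosh ξ))⁻¹ : ℝ) : ℂ) = a at *
  field_simp

theorem tendsto_phaseCorrected_div_leadingTerm (hσ : σ = 1 ∨ σ = -1) {ι : Type*} {L : Filter ι}
    {x : ι → ℝ} {κ : ι → ℂ} (hx : Tendsto x L atTop)
    (hV : Tendsto (fun i => V (x i) (σ * κ i) / comparison Z (x i) (σ * κ i)) L (𝓝 1))
    (hΘ : Tendsto (fun i => φ (x i) (κ i) - phase Z (x i) (κ i) - Θ (κ i)) L (𝓝 0)) :
    Tendsto (fun i => phaseCorrected σ Θ V (x i) (κ i) / leadingTerm σ φ (x i) (κ i)) L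
      (𝓝 1) := by
  have hratio : Tendsto (fun i => (amplitudeRatio (x i) : ℂ)) L (𝓝 1) := by
    exact_mod_cast (tendsto_amplitudeRatio.comp hx).ofReal
  have hexp := (hΘ.const_mul (-(σ * Complex.I))).cexp
  simpa only [← phaseCorrected_div_leadingTerm hσ, mul_zero, Complex.exp_zero, one_mul] using
    (hV.mul hratio).mul hexp

theorem HasAsymptotics.tendsto_div_congr {v w y : ℝ → ℂ} {c : ℂ}
    (hv : HasAsymptotics σ φ k v) (hw : HasAsymptotics σ φ k w)
    (hvc : Tendsto (fun ξ => v ξ / y ξ) atTop (𝓝 c)) :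
    Tendsto (fun ξ => w ξ / y ξ) atTop (𝓝 c) := by
  have hwv : Tendsto (fun ξ => w ξ / leadingTerm σ φ ξ k / (v ξ / leadingTerm σ φ ξ k) *
      (v ξ / y ξ)) atTop (𝓝 c) := by simpa using (hw.div hv one_ne_zero).mul hvc
  refine hwv.congr' ?_
  filter_upwards [hv.eventually_ne one_ne_zero] with ξ hξ
  have hv₀ : v ξ ≠ 0 := fun h₀ => hξ (by rw [h₀, zero_div])
  rw [div_div_div_cancel_right₀ (leadingTerm_ne_zero σ φ ξ k), div_mul_div_cancel₀ hv₀]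

namespace IsJostFamily

theorem isRadialSolution_phaseCorrected (hV : IsJostFamily Z μ V)
    (hσ : σ = 1 ∨ σ = -1) (Θ : ℂ → ℂ) (hk₀ : k ≠ 0) :
    IsRadialSolution Z μ k (fun ξ => phaseCorrected σ Θ V ξ k) := by
  obtain ⟨v', hv⟩ := hV.exists_isSolutionPair _ (sign_mul_ne_zero hσ hk₀)
  exact (isRadialSolution_iff hσ).2 ⟨_, hv.const_mul _⟩

theorem hasAsymptotics_phaseCorrected (hV : IsJostFamily Z μ V)
    (hΘ : IsPhaseCorrection Z φ Θ) (hσ : σ = 1 ∨ σ = -1) (hk₀ : k ≠ 0) :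
    HasAsymptotics σ φ k (fun ξ => phaseCorrected σ Θ V ξ k) := by
  have hlim := (hΘ.tendstoUniformlyOn ‖k‖ (norm_pos_iff.2 hk₀)).tendsto_at (le_refl ‖k‖)
  exact tendsto_phaseCorrected_div_leadingTerm hσ (x := id) (κ := fun _ => k) tendsto_id
    (hV.tendsto_div _ (sign_mul_ne_zero hσ hk₀)) (tendsto_sub_nhds_zero_iff.2 hlim)

theorem eq_phaseCorrected (hV : IsJostFamily Z μ V) (hΘ : IsPhaseCorrection Z φ Θ)
    (hσ : σ = 1 ∨ σ = -1) (hk : k ∈ closure (halfPlane σ) \ {0}) {w : ℝ → ℂ}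
    (hw : IsRadialSolution Z μ k w) (hwφ : HasAsymptotics σ φ k w) {ξ : ℝ} (hξ : 0 < ξ) :
    w ξ = phaseCorrected σ Θ V ξ k := by
  have hσk := sign_mul_ne_zero hσ hk.2
  obtain ⟨v', hv⟩ := (isRadialSolution_iff hσ).1 (hV.isRadialSolution_phaseCorrected hσ Θ hk.2)
  obtain ⟨w', hw⟩ := (isRadialSolution_iff hσ).1 hw
  have hvc : Tendsto (fun ξ => phaseCorrected σ Θ V ξ k / comparison Z ξ (σ * k)) atTop
      (𝓝 (Complex.exp (σ * Complex.I * Θ k))) := by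
    simpa only [phaseCorrected, mul_div_assoc, mul_one] using
      (hV.tendsto_div _ hσk).const_mul (Complex.exp (σ * Complex.I * Θ k))
  have hwc := (hV.hasAsymptotics_phaseCorrected hΘ hσ hk.2).tendsto_div_congr hwφ hvc
  exact hV.eq_of_tendsto_div (sign_mul_im_nonneg hk.1) hσk hw hv hwc hvc hξ

theorem tendstoUniformlyOn_phaseCorrected (hV : IsJostFamily Z μ V)
    (hΘ : IsPhaseCorrection Z φ Θ) (hσ : σ = 1 ∨ σ = -1) {η δ : ℝ} (hη : 0 ≤ η) (hδ : 0 < δ) :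
    TendstoUniformlyOn (fun ξ k => phaseCorrected σ Θ V ξ k / leadingTerm σ φ ξ k) (fun _ => 1)
      atTop (truncatedCone σ η δ) := by
  rw [← tendsto_prod_principal_iff]
  refine tendsto_phaseCorrected_div_leadingTerm (Z := Z) hσ (x := Prod.fst) (κ := Prod.snd)
    tendsto_fst ?_ ?_
  · exact (tendsto_prod_principal_iff.2 (hV.tendstoUniformlyOn_div δ hδ)).comp
      (tendsto_id.prodMap (tendsto_principal_principal.2 fun k hk =>
        sign_mul_mem_upperDomain hσ hη hk))
  · refine (tendsto_prod_principal_iff (F := fun ξ k => φ ξ k - phase Z ξ k - Θ k)).2 ?_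
    have hlim := (hΘ.tendstoUniformlyOn δ hδ).mono fun k (hk : k ∈ truncatedCone σ η δ) =>
      hk.2.2.2
    simp only [Metric.tendstoUniformlyOn_iff, dist_eq_norm_sub', sub_zero] at hlim ⊢
    exact hlim

theorem analyticOnNhd_phaseCorrected (hV : IsJostFamily Z μ V)
    (hΘ : DifferentiableOn ℂ Θ {0}ᶜ) {ξ : ℝ} (hξ : 0 < ξ) :
    AnalyticOnNhd ℂ (phaseCorrected σ Θ V ξ) (halfPlane σ) :=
  DifferentiableOn.analyticOnNhd
    (((hΘ.mono fun _ hk => ne_zero_of_mem_halfPlane hk).const_mul _).cexp.mul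
      ((hV.differentiableOn ξ hξ).comp (by fun_prop) fun _ hk => sign_mul_im_pos hk))
    (isOpen_halfPlane σ)

theorem continuousOn_phaseCorrected (hV : IsJostFamily Z μ V)
    (hΘ : ContinuousOn Θ {0}ᶜ) (hσ : σ = 1 ∨ σ = -1) {ξ : ℝ} (hξ : 0 < ξ) :
    ContinuousOn (phaseCorrected σ Θ V ξ) (closure (halfPlane σ) \ {0}) :=
  (continuousOn_const.mul (hΘ.mono fun _ hk => hk.2)).cexp.mul
    ((hV.continuousOn ξ hξ).comp (by fun_prop) fun _ hk =>
      ⟨sign_mul_im_nonneg hk.1, sign_mul_ne_zero hσ hk.2⟩)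

end IsJostFamily

end Asymptotics

end TwoCentre

end

theorem theorem4p3_general (Z : ℝ) (μ : ℂ) (φ : ℝ → ℂ → ℂ) (Θ : ℂ → ℂ)
    (hΘ : TwoCentre.IsPhaseCorrection Z φ Θ) (σ : ℝ) (hσ : σ = 1 ∨ σ = -1) :
    ∃ v : ℝ → ℂ → ℂ,
      (∀ k : ℂ, k ≠ 0 →
        TwoCentre.IsRadialSolution Z μ k (fun ξ => v ξ k) ∧
        TwoCentre.HasAsymptotics σ φ k (fun ξ => v ξ k)) ∧
      (∀ k ∈ closure (TwoCentre.halfPlane σ) \ {0}, ∀ w : ℝ → ℂ,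
        TwoCentre.IsRadialSolution Z μ k w → TwoCentre.HasAsymptotics σ φ k w →
        ∀ ξ : ℝ, 0 < ξ → w ξ = v ξ k) ∧
      (∀ η δ : ℝ, 0 ≤ η → 0 < δ →
        TendstoUniformlyOn (fun (ξ : ℝ) (k : ℂ) => v ξ k / TwoCentre.leadingTerm σ φ ξ k)
          (fun _ => 1) atTop (TwoCentre.truncatedCone σ η δ)) ∧
      (∀ ξ : ℝ, 0 < ξ → AnalyticOnNhd ℂ (fun k => v ξ k) (TwoCentre.halfPlane σ)) ∧
      (∀ ξ : ℝ, 0 < ξ →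
        ContinuousOn (fun k => v ξ k) (closure (TwoCentre.halfPlane σ) \ {0})) := by
  obtain ⟨V, hV⟩ := TwoCentre.exists_isJostFamily Z μ
  exact ⟨TwoCentre.phaseCorrected σ Θ V,
    fun k hk₀ => ⟨hV.isRadialSolution_phaseCorrected hσ Θ hk₀,
      hV.hasAsymptotics_phaseCorrected hΘ hσ hk₀⟩,
    fun k hk w hw hwφ ξ hξ => hV.eq_phaseCorrected hΘ hσ hk hw hwφ hξ,
    fun η δ hη hδ => hV.tendstoUniformlyOn_phaseCorrected hΘ hσ hη hδ,
    fun ξ hξ => hV.analyticOnNhd_phaseCorrected hΘ.differentiableOn hξ,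
    fun ξ hξ => hV.continuousOn_phaseCorrected hΘ.differentiableOn.continuousOn hσ hξ⟩

theorem theorem4p3 (Z : ℝ) (μ : ℂ) (φ : ℝ → ℂ → ℂ) (hφ : TwoCentre.IsGlobalPhase Z μ φ)
    (σ : ℝ) (hσ : σ = 1 ∨ σ = -1) :
    ∃ v : ℝ → ℂ → ℂ,
      -- existence, for every nonzero `k`
      (∀ k : ℂ, k ≠ 0 →
        TwoCentre.IsRadialSolution Z μ k (fun ξ => v ξ k) ∧
        TwoCentre.HasAsymptotics σ φ k (fun ξ => v ξ k)) ∧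
      -- uniqueness, on the closed half-plane without `0`
      (∀ k ∈ closure (TwoCentre.halfPlane σ) \ {0}, ∀ w : ℝ → ℂ,
        TwoCentre.IsRadialSolution Z μ k w → TwoCentre.HasAsymptotics σ φ k w →
        ∀ ξ : ℝ, 0 < ξ → w ξ = v ξ k) ∧
      -- uniformity of the asymptotics in truncated cones
      (∀ η δ : ℝ, 0 ≤ η → 0 < δ →
        TendstoUniformlyOn (fun (ξ : ℝ) (k : ℂ) => v ξ k / TwoCentre.leadingTerm σ φ ξ k)
          (fun _ => 1) atTop (TwoCentre.truncatedCone σ η δ)) ∧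
      -- analyticity in the open half-plane, continuity up to the boundary
      (∀ ξ : ℝ, 0 < ξ → AnalyticOnNhd ℂ (fun k => v ξ k) (TwoCentre.halfPlane σ)) ∧
      (∀ ξ : ℝ, 0 < ξ →
        ContinuousOn (fun k => v ξ k) (closure (TwoCentre.halfPlane σ) \ {0})) := by
  obtain ⟨Θ, hΘ⟩ := hφ.exists_isPhaseCorrection
  exact theorem4p3_general Z μ φ Θ hΘ σ hσ
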